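/- Let $X$ be a finite set and $\mathcal P(X)$ the set of probability measures on $X$, viewed as a simplex in $\mathbb R^X$. For each $x\in X$ let $K_x:\mathcal P(X)\to\mathbb R$ be twice continuously differentiable, and set $$U(\mu)=\sum_x\mu_xK_x(\mu),\qquad \mathcal F(\mu)=\sum_x\mu_x\log\mu_x+U(\mu),\qquad \pi_x(\mu)=\frac{e^{-H_x(\mu)}}{Z(\mu)},\quad H_x(\mu)=\frac{\partial U}{\partial\mu_x}(\mu),$$ where $Z(\mu)$ is the normalizing constant. For each $\mu\in\mathcal P(X)$ let $Q(\mu)=(Q_{xy}(\mu))_{x,y\in X}$ be an irreducible rate matrix ($Q_{xy}(\mu)\ge0$ for $x\ne y$ and $Q_{xx}(\mu)=-\sum_{y\neq x}Q_{xy}(\mu)$) that is reversible with respect to $\pi(\mu)$, i.e. $\pi_x(\mu)Q_{xy}(\mu)=\pi_y(\mu)Q_{yx}(\mu)$, and such that each $\mu\mapsto Q_{xy}(\mu)$ is Lipschitz on $\mathcal P(X)$. Let $\Lambda(a,b)=\int_0^1a^{1-s}b^s\,ds$, $\Lambda(\mu)_{xy}=\Lambda(\mu_xQ_{xy}(\mu),\mu_yQ_{yx}(\mu))$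 and $\mathcal A(\mu,\psi)=\frac12\sum_{x,y}(\psi_y-\psi_x)^2\Lambda(\mu)_{xy}$ for $\psi\in\mathbb R^X$. For $\mu_0,\mu_1\in\mathcal P(X)$ let $$\mathcal W(\mu_0,\mu_1)=\inf\Big(\int_0^1\mathcal A(\mu_t,\psi_t)\,dt\Big)^{1/2},$$ where the infimum is over all continuous curves $(\mu_t)_{t\in[0,1]}$ in $\mathcal P(X)$ from $\mu_0$ to $\mu_1$ and all measurable, integrable $(\psi_t)_{t\in[0,1]}$ in $\mathbb R^X$ satisfying $$\dot\mu_t(x)=-\sum_{y}\Lambda(\mu_t)_{xy}\,(\psi_t(y)-\psi_t(x)),\qquad x\in X,$$ in the sense of distributions on $(0,1)$. Let $\mathcal I(\mu)=\frac12\sum_{x,y}\Theta(\mu_xQ_{xy}(\mu),\mu_yQ_{yx}(\mu))$ with $\Theta(a,b)=(a-b)(\log a-\log b)$, $\Theta(0,0)=0$, if $\mu_x>0$ for all $x$, and $\mathcal I(\mu)=+\infty$ otherwise. Let $\kappa\in\mathbb R$ and assume $\mathrm{Ric}(X,Q,\pi)\ge\kappa$, i.e. for every constant speed $\mathcal W$-geodesic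 $(\mu_t)_{t\in[0,1]}$ in $\mathcal P(X)$ (that is, $\mathcal W(\mu_s,\mu_t)=|s-t|\,\mathcal W(\mu_0,\mu_1)<\infty$ for all $s,t\in[0,1]$) and every $t\in[0,1]$, $$\mathcal F(\mu_t)\le(1-t)\mathcal F(\mu_0)+t\mathcal F(\mu_1)-\frac\kappa2t(1-t)\,\mathcal W(\mu_0,\mu_1)^2.$$ Then for all $\mu,\nu\in\mathcal P(X)$ the distance $\mathcal W(\mu,\nu)$ is finite and $$\mathcal F(\mu)\le\mathcal F(\nu)+\mathcal W(\mu,\nu)\sqrt{\mathcal I(\mu)}-\frac\kappa2\,\mathcal W(\mu,\nu)^2,$$ where $0\cdot\infty=0$. -/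

import Mathlib

open scoped ENNReal ContDiff

noncomputable section

/-! Throughout, `X` is a finite set, `stdSimplex ℝ X` is the set of probability measures on `X`,
`K μ x` is the potential and `Q μ x y` the rate from `x` to `y` at the measure `μ`. Only values at
measures `μ` in the simplex ever matter. -/

namespace MeanField

variable {X : Type*} [Fintype X]

/-- The potential energy `U(μ) = ∑ₓ μₓ Kₓ(μ)`. -/
def potentialEnergy (K : (X → ℝ) → X → ℝ) (μ : X → ℝ) : ℝ :=
  ∑ x, μ x * K μ x

/-- The free energy `F(μ) = ∑ₓ μₓ log μₓ + U(μ)` (with `0 log 0 = 0`). -/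
def freeEnergy (K : (X → ℝ) → X → ℝ) (μ : X → ℝ) : ℝ :=
  ∑ x, μ x * Real.log (μ x) + potentialEnergy K μ

/-- `Hₓ(μ) = ∂U/∂μₓ (μ)`. As `U` is a function on the simplex, its differential at `μ` is only
determined up to a multiple of `v ↦ ∑ₓ vₓ`, so `H(μ)` is only determined up to an additive constant
(the same for all `x`); the normalization in `gibbsMeasure` removes this ambiguity, see
`gibbsMeasure_eq`. -/
def gibbsPotential [DecidableEq X] (K : (X → ℝ) → X → ℝ) (μ : X → ℝ) (x : X) : ℝ :=
  fderivWithin ℝ (potentialEnergy K) (stdSimplex ℝ X) μ (Pi.single x 1)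

/-- The local Gibbs measure `πₓ(μ) = exp(-Hₓ(μ)) / Z(μ)`. -/
def gibbsMeasure [DecidableEq X] (K : (X → ℝ) → X → ℝ) (μ : X → ℝ) (x : X) : ℝ :=
  Real.exp (-gibbsPotential K μ x) / ∑ y, Real.exp (-gibbsPotential K μ y)

/-- The local Gibbs measure may be computed from any differential of `U` along the simplex, for
instance from the partial derivatives of any differentiable extension of `U`. -/
theorem gibbsMeasure_eq [DecidableEq X] {K : (X → ℝ) → X → ℝ} {μ : X → ℝ}
    (hμ : μ ∈ stdSimplex ℝ X) {D : (X → ℝ) →L[ℝ] ℝ}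
    (hD : HasFDerivWithinAt (potentialEnergy K) D (stdSimplex ℝ X) μ) (x : X) :
    gibbsMeasure K μ x =
      Real.exp (-D (Pi.single x 1)) / ∑ y, Real.exp (-D (Pi.single y 1)) := by
  have hD' := hD.differentiableWithinAt.hasFDerivWithinAt
  set E := fderivWithin ℝ (potentialEnergy K) (stdSimplex ℝ X) μ with hE
  have key : ∀ y, E (Pi.single y 1) - D (Pi.single y 1) = E μ - D μ := by
    intro y
    have hy : (Pi.single y 1 : X → ℝ) ∈ stdSimplex ℝ X := single_mem_stdSimplex ℝ y
    have ht := mem_tangentConeAt_of_segment_subset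
      ((convex_stdSimplex ℝ X).segment_subset hμ hy)
    have h := hD'.unique_on hD ht
    rw [map_sub, map_sub] at h
    linarith
  have hexp : ∀ y, Real.exp (-gibbsPotential K μ y) =
      Real.exp (-(E μ - D μ)) * Real.exp (-D (Pi.single y 1)) := by
    intro y
    rw [← Real.exp_add, ← key y]
    congr 1
    simp only [gibbsPotential, ← hE]
    ring
  simp only [gibbsMeasure, hexp, ← Finset.mul_sum]
  exact mul_div_mul_left _ _ (Real.exp_pos _).ne'

/-- `(X, Q, π)` is a non-linear Markov triple: `K` is twice continuously differentiable on the
simplex, each `Q(μ)` is an irreducible rate matrix which is reversible with respect to the local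
Gibbs measure `π(μ)`, and `Q` is Lipschitz on the simplex. -/
structure IsNonlinearMarkovTriple [DecidableEq X] (K : (X → ℝ) → X → ℝ)
    (Q : (X → ℝ) → X → X → ℝ) : Prop where
  contDiffOn_potential : ∀ x, ContDiffOn ℝ 2 (fun μ => K μ x) (stdSimplex ℝ X)
  rate_nonneg : ∀ μ ∈ stdSimplex ℝ X, ∀ x y, x ≠ y → 0 ≤ Q μ x y
  rate_diag : ∀ μ ∈ stdSimplex ℝ X, ∀ x, Q μ x x = -∑ y ∈ Finset.univ.erase x, Q μ x y
  irreducible : ∀ μ ∈ stdSimplex ℝ X, ∀ x y, Relation.ReflTransGen (fun a b => 0 < Q μ a b) x y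
  detailed_balance : ∀ μ ∈ stdSimplex ℝ X, ∀ x y,
    gibbsMeasure K μ x * Q μ x y = gibbsMeasure K μ y * Q μ y x
  lipschitz_rate : ∀ x y, ∃ C, LipschitzOnWith C (fun μ => Q μ x y) (stdSimplex ℝ X)

/-- The logarithmic mean `Λ(a, b) = ∫₀¹ a^(1-s) b^s ds` of `a, b ≥ 0`. -/
def logMean (a b : ℝ) : ℝ :=
  ∫ s in (0 : ℝ)..1, a ^ (1 - s) * b ^ s

/-- The weights `Λ(μ)(x, y) = Λ(μₓ Q(μ; x, y), μ_y Q(μ; y, x))`. They are only used for `x ≠ y`: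
below, the diagonal terms are multiplied by `ψ x - ψ x = 0`. -/
def edgeWeight (Q : (X → ℝ) → X → X → ℝ) (μ : X → ℝ) (x y : X) : ℝ :=
  logMean (μ x * Q μ x y) (μ y * Q μ y x)

/-- The Onsager operator `𝒦[μ]ψ = -∇·(Λ(μ) ∇ψ)`, i.e.
`𝒦[μ]ψ(x) = -∑_y Λ(μ)(x, y) (ψ(y) - ψ(x))`. -/
def onsager (Q : (X → ℝ) → X → X → ℝ) (μ ψ : X → ℝ) (x : X) : ℝ :=
  -∑ y, edgeWeight Q μ x y * (ψ y - ψ x)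

/-- The action `𝒜(μ, ψ) = ⟨ψ, 𝒦[μ]ψ⟩ = ½ ∑_{x,y} (ψ(y) - ψ(x))² Λ(μ)(x, y)`. -/
def action (Q : (X → ℝ) → X → X → ℝ) (μ ψ : X → ℝ) : ℝ :=
  (1 / 2) * ∑ x, ∑ y, (ψ y - ψ x) ^ 2 * edgeWeight Q μ x y

/-- `(μ, ψ)` solves the continuity equation `∂ₜμₜ = 𝒦[μₜ]ψₜ` on `[0, 1]` and joins `μ₀` to `μ₁`:
`t ↦ μₜ` is a continuous curve of probability measures, `t ↦ ψₜ` is measurable and integrable, and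
the equation holds in the sense of distributions on `(0, 1)`. -/
structure IsCESolution (Q : (X → ℝ) → X → X → ℝ) (μ₀ μ₁ : X → ℝ) (μ ψ : ℝ → X → ℝ) : Prop where
  continuousOn : ContinuousOn μ (Set.Icc 0 1)
  mem_simplex : ∀ t ∈ Set.Icc (0 : ℝ) 1, μ t ∈ stdSimplex ℝ X
  left_eq : μ 0 = μ₀
  right_eq : μ 1 = μ₁
  integrable : ∀ x, MeasureTheory.IntegrableOn (fun t => ψ t x) (Set.Icc 0 1)
  weak_equation : ∀ φ : ℝ → ℝ, ContDiff ℝ ∞ φ → HasCompactSupport φ →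
    tsupport φ ⊆ Set.Ioo 0 1 → ∀ x,
      ∫ t in Set.Ioo (0 : ℝ) 1, deriv φ t * μ t x =
        -∫ t in Set.Ioo (0 : ℝ) 1, φ t * onsager Q (μ t) (ψ t) x

/-- The transport distance
`W(μ₀, μ₁) = inf { (∫₀¹ 𝒜(μₜ, ψₜ) dt)^(1/2) : (μ, ψ) ∈ CE joins μ₀ to μ₁ }`. -/
def transportDist (Q : (X → ℝ) → X → X → ℝ) (μ₀ μ₁ : X → ℝ) : ℝ≥0∞ :=
  ⨅ (μ : ℝ → X → ℝ) (ψ : ℝ → X → ℝ) (_ : IsCESolution Q μ₀ μ₁ μ ψ),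
    (∫⁻ t in Set.Icc (0 : ℝ) 1, ENNReal.ofReal (action Q (μ t) (ψ t))) ^ (1 / 2 : ℝ)

/-- A `W`-geodesic `(γₜ)_{t ∈ [0,1]}` in the simplex:
`W(γₛ, γₜ) = |s - t| W(γ₀, γ₁) < ∞` for all `s, t`. -/
structure IsGeodesic (Q : (X → ℝ) → X → X → ℝ) (γ : ℝ → X → ℝ) : Prop where
  mem_simplex : ∀ t ∈ Set.Icc (0 : ℝ) 1, γ t ∈ stdSimplex ℝ X
  dist_lt_top : transportDist Q (γ 0) (γ 1) < ⊤
  dist_eq : ∀ s ∈ Set.Icc (0 : ℝ) 1, ∀ t ∈ Set.Icc (0 : ℝ) 1,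
    transportDist Q (γ s) (γ t) = ENNReal.ofReal |s - t| * transportDist Q (γ 0) (γ 1)

/-- `Ric(X, Q, π) ≥ κ`: the free energy is `κ`-convex along all `W`-geodesics. -/
def RicciBoundedBelow (K : (X → ℝ) → X → ℝ) (Q : (X → ℝ) → X → X → ℝ) (κ : ℝ) : Prop :=
  ∀ γ : ℝ → X → ℝ, IsGeodesic Q γ → ∀ t ∈ Set.Icc (0 : ℝ) 1,
    freeEnergy K (γ t) ≤ (1 - t) * freeEnergy K (γ 0) + t * freeEnergy K (γ 1)
      - κ / 2 * t * (1 - t) * (transportDist Q (γ 0) (γ 1)).toReal ^ 2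

/-- `Θ(a, b) = (a - b) (log a - log b)` (used only for `a, b > 0` or `a = b`). -/
def thetaFn (a b : ℝ) : ℝ :=
  (a - b) * (Real.log a - Real.log b)

open Classical in
/-- The discrete Fisher information: `I(μ) = ½ ∑_{x,y} Θ(μₓ Q(μ; x, y), μ_y Q(μ; y, x))` if `μ` is
strictly positive, and `I(μ) = ∞` otherwise. -/
def fisherInfo (Q : (X → ℝ) → X → X → ℝ) (μ : X → ℝ) : ℝ≥0∞ :=
  if ∀ x, 0 < μ x then
    ENNReal.ofReal ((1 / 2) * ∑ x, ∑ y, thetaFn (μ x * Q μ x y) (μ y * Q μ y x))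
  else ⊤

end MeanField

end

noncomputable section

namespace MeanField

open MeasureTheory Set Filter Topology

/-! At a strictly positive `μ` the Fisher information is the action of the differential of the free
energy (`fisherInfo_eq`): detailed balance turns differences of that differential into differences
of logarithms of flows, and the logarithmic mean satisfies `Λ(a,b)(log a - log b) = a - b`.
Cauchy–Schwarz for the action then bounds the rate at which `F` can decrease along a curve leaving
`μ` with speed `W` by `√I · W` (`eventually_le_freeEnergy`). Along a geodesic from `μ` to `ν`,
`κ`-convexity gives `F(μ) ≤ F(ν) - κ/2 (1-t) W² + (F(μ) - F(γ_t))/t`, and `t → 0` yields the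
inequality (`freeEnergy_le_of_pos`). If `μ` charges only part of `X`, then `I(μ) = ∞` and only the
case `W = 0` matters, where `μ = ν`.

The main work is to show that `W` is finite and that geodesics exist. Both follow from Euclidean
continuity of `W` (`eventually_transportDist_lt`). A smooth curve is turned into a solution of the
continuity equation by solving a weighted Laplace equation at each time. Its potential is bounded as
soon as the flow through every cut is controlled by the weight of that cut (`sub_le_of_cut_le`,
`exists_isPath_of_cut_le`). In the interior of the simplex, straight segments do. Near the boundary,
where weights degenerate, a discrete heat flow moves measures inward at a small cost, uniformly near
a given measure (`exists_deformation`): its flow through an edge is a logarithmic mean times a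
logarithmic difference, which is only `O(log(1/t))` and so square integrable in time.

Finiteness of `W` follows because the simplex is connected. For geodesics, pointwise ultralimits of
almost optimal curves suffice (`exists_isGeodesic`): an inequality between the distances of three
consecutive pieces survives the limit and forces constant speed, so neither an optimal potential nor
lower semicontinuity of the action is needed. -/

/-! ### The logarithmic mean. -/

lemma logMean_integrand_nonneg {a b : ℝ} (ha : 0 ≤ a) (hb : 0 ≤ b) (s : ℝ) :
    0 ≤ a ^ (1 - s) * b ^ s :=
  mul_nonneg (Real.rpow_nonneg ha _) (Real.rpow_nonneg hb _)

lemma logMean_integrand_le {a b s : ℝ} (ha : 0 ≤ a) (hb : 0 ≤ b) (hs : s ∈ Icc (0 : ℝ) 1) :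
    a ^ (1 - s) * b ^ s ≤ a + b := by
  have h := Real.geom_mean_le_arith_mean2_weighted (w₁ := 1 - s) (w₂ := s) (by linarith [hs.2])
    hs.1 ha hb (by ring)
  nlinarith [hs.1, hs.2]

lemma measurable_logMean_integrand (a b : ℝ) : Measurable fun s : ℝ => a ^ (1 - s) * b ^ s := by
  fun_prop

lemma intervalIntegrable_logMean_integrand {a b : ℝ} (ha : 0 ≤ a) (hb : 0 ≤ b) :
    IntervalIntegrable (fun s : ℝ => a ^ (1 - s) * b ^ s) volume 0 1 := by
  rw [intervalIntegrable_iff_integrableOn_Icc_of_le zero_le_one]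
  refine Measure.integrableOn_of_bounded (M := a + b) (by simp)
    (measurable_logMean_integrand a b).aestronglyMeasurable ?_
  filter_upwards [ae_restrict_mem measurableSet_Icc] with s hs
  rw [Real.norm_of_nonneg (logMean_integrand_nonneg ha hb s)]
  exact logMean_integrand_le ha hb hs

lemma logMean_nonneg {a b : ℝ} (ha : 0 ≤ a) (hb : 0 ≤ b) : 0 ≤ logMean a b :=
  intervalIntegral.integral_nonneg zero_le_one fun s _ => logMean_integrand_nonneg ha hb s

lemma logMean_comm (a b : ℝ) : logMean a b = logMean b a := by
  have h := intervalIntegral.integral_comp_sub_left (a := 0) (b := 1)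
    (fun s : ℝ => a ^ (1 - s) * b ^ s) 1
  simp only [sub_self, sub_zero] at h
  rw [logMean, ← h, logMean]
  refine intervalIntegral.integral_congr fun s _ => ?_
  simp only [sub_sub_cancel]
  ring

lemma logMean_mono {a b a' b' : ℝ} (ha : 0 ≤ a) (hb : 0 ≤ b) (haa : a ≤ a') (hbb : b ≤ b') :
    logMean a b ≤ logMean a' b' := by
  refine intervalIntegral.integral_mono_on zero_le_one
    (intervalIntegrable_logMean_integrand ha hb)
    (intervalIntegrable_logMean_integrand (ha.trans haa) (hb.trans hbb)) fun s hs => ?_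
  exact mul_le_mul (Real.rpow_le_rpow ha haa (by linarith [hs.2])) (Real.rpow_le_rpow hb hbb hs.1)
    (Real.rpow_nonneg hb _) (Real.rpow_nonneg (ha.trans haa) _)

lemma logMean_mul {c a b : ℝ} (hc : 0 < c) (ha : 0 ≤ a) (hb : 0 ≤ b) :
    logMean (c * a) (c * b) = c * logMean a b := by
  rw [logMean, logMean, ← intervalIntegral.integral_const_mul]
  refine intervalIntegral.integral_congr fun s _ => ?_
  rw [Real.mul_rpow hc.le ha, Real.mul_rpow hc.le hb]
  have : c ^ (1 - s) * c ^ s = c := by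
    rw [← Real.rpow_add hc]; simp
  linear_combination a ^ (1 - s) * b ^ s * this

lemma logMean_self {a : ℝ} (ha : 0 < a) : logMean a a = a := by
  have : ∀ s : ℝ, a ^ (1 - s) * a ^ s = a := fun s => by rw [← Real.rpow_add ha]; simp
  simp [logMean, this]

lemma logMean_pos {a b : ℝ} (ha : 0 < a) (hb : 0 < b) : 0 < logMean a b := by
  have hm := lt_min ha hb
  calc 0 < min a b := hm
    _ = logMean (min a b) (min a b) := (logMean_self hm).symm
    _ ≤ _ := logMean_mono hm.le hm.le (min_le_left _ _) (min_le_right _ _)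

/-- The integrand is its own derivative in `s` up to the factor `log b - log a`. The product form
avoids dividing by zero when `a = b`. -/
lemma logMean_mul_log_sub_log {a b : ℝ} (ha : 0 < a) (hb : 0 < b) :
    logMean a b * (Real.log a - Real.log b) = a - b := by
  have hd : ∀ s : ℝ, HasDerivAt (fun s : ℝ => a ^ (1 - s) * b ^ s)
      (a ^ (1 - s) * b ^ s * (Real.log b - Real.log a)) s := by
    intro s
    have h1 : HasDerivAt (fun s : ℝ => a ^ (1 - s)) (Real.log a * (-1) * a ^ (1 - s)) s :=
      ((hasDerivAt_id s).const_sub 1).const_rpow ha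
    have h2 : HasDerivAt (fun s : ℝ => b ^ s) (Real.log b * 1 * b ^ s) s :=
      (hasDerivAt_id s).const_rpow hb
    exact (h1.fun_mul h2).congr_deriv (by ring)
  have h := intervalIntegral.integral_eq_sub_of_hasDerivAt (a := 0) (b := 1) (fun s _ => hd s)
    ((intervalIntegrable_logMean_integrand ha.le hb.le).mul_const _)
  rw [intervalIntegral.integral_mul_const] at h
  simp only [sub_self, sub_zero, Real.rpow_zero, Real.rpow_one, one_mul, mul_one] at h
  rw [logMean]
  linarith

/-- Dominated convergence, with the local majorant supplied by weighted AM-GM. The closed quadrant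
matters: flows vanish at the boundary of the simplex. -/
lemma continuousOn_logMean :
    ContinuousOn (fun p : ℝ × ℝ => logMean p.1 p.2) (Ici 0 ×ˢ Ici 0) := by
  intro p hp
  simp only [logMean, intervalIntegral.integral_of_le zero_le_one, integral_Ioc_eq_integral_Ioo]
  have hnear : ∀ᶠ q : ℝ × ℝ in 𝓝[Ici 0 ×ˢ Ici 0] p,
      (0 ≤ q.1 ∧ 0 ≤ q.2) ∧ q.1 + q.2 < p.1 + p.2 + 1 := by
    refine Filter.Eventually.and ?_ ?_
    · filter_upwards [self_mem_nhdsWithin] with q hq using ⟨hq.1, hq.2⟩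
    · exact nhdsWithin_le_nhds ((continuous_fst.add continuous_snd).continuousAt.eventually_lt
        continuousAt_const (by simp))
  refine tendsto_integral_filter_of_dominated_convergence (fun _ => p.1 + p.2 + 1) ?_ ?_ ?_ ?_
  · exact Eventually.of_forall fun q => (measurable_logMean_integrand _ _).aestronglyMeasurable
  · filter_upwards [hnear] with q hq
    filter_upwards [ae_restrict_mem measurableSet_Ioo] with s hs
    rw [Real.norm_of_nonneg (logMean_integrand_nonneg hq.1.1 hq.1.2 s)]
    exact (logMean_integrand_le hq.1.1 hq.1.2 ⟨hs.1.le, hs.2.le⟩).trans hq.2.le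
  · exact integrable_const _
  · filter_upwards [ae_restrict_mem measurableSet_Ioo] with s hs
    refine Tendsto.mono_left ?_ nhdsWithin_le_nhds
    refine Tendsto.mul ?_ ?_
    · exact (continuous_fst.tendsto p).rpow_const (Or.inr (by linarith [hs.2]))
    · exact (continuous_snd.tendsto p).rpow_const (Or.inr hs.1.le)

/-! ### Edge weights on the simplex. -/

section EdgeWeight

variable {X : Type*}

lemma edgeWeight_comm (Q : (X → ℝ) → X → X → ℝ) (μ : X → ℝ) (x y : X) :
    edgeWeight Q μ x y = edgeWeight Q μ y x :=
  logMean_comm _ _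

variable [Fintype X] [DecidableEq X] {K : (X → ℝ) → X → ℝ} {Q : (X → ℝ) → X → X → ℝ}

namespace IsNonlinearMarkovTriple

lemma flow_nonneg (hQ : IsNonlinearMarkovTriple K Q) {μ : X → ℝ} (hμ : μ ∈ stdSimplex ℝ X)
    {x y : X} (hxy : x ≠ y) : 0 ≤ μ x * Q μ x y :=
  mul_nonneg (hμ.1 x) (hQ.rate_nonneg μ hμ x y hxy)

lemma edgeWeight_nonneg (hQ : IsNonlinearMarkovTriple K Q) {μ : X → ℝ} (hμ : μ ∈ stdSimplex ℝ X)
    {x y : X} (hxy : x ≠ y) : 0 ≤ edgeWeight Q μ x y :=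
  logMean_nonneg (hQ.flow_nonneg hμ hxy) (hQ.flow_nonneg hμ hxy.symm)

lemma continuousOn_rate (hQ : IsNonlinearMarkovTriple K Q) (x y : X) :
    ContinuousOn (fun μ => Q μ x y) (stdSimplex ℝ X) := by
  obtain ⟨C, hC⟩ := hQ.lipschitz_rate x y
  exact hC.continuousOn

/-- The diagonal is excluded because `Q μ x x` is nonpositive, which puts the arguments of `logMean`
outside the quadrant where it is controlled. -/
lemma continuousOn_edgeWeight (hQ : IsNonlinearMarkovTriple K Q) {x y : X} (hxy : x ≠ y) :
    ContinuousOn (fun μ => edgeWeight Q μ x y) (stdSimplex ℝ X) := by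
  have h : ContinuousOn (fun μ : X → ℝ => (μ x * Q μ x y, μ y * Q μ y x)) (stdSimplex ℝ X) :=
    ((continuous_apply x).continuousOn.mul (hQ.continuousOn_rate x y)).prodMk
      ((continuous_apply y).continuousOn.mul (hQ.continuousOn_rate y x))
  exact continuousOn_logMean.comp h fun μ hμ =>
    ⟨hQ.flow_nonneg hμ hxy, hQ.flow_nonneg hμ hxy.symm⟩

/-- The off-diagonal edge weights are bounded on the simplex. -/
lemma exists_edgeWeight_le (hQ : IsNonlinearMarkovTriple K Q) :
    ∃ C : ℝ, 0 < C ∧ ∀ μ ∈ stdSimplex ℝ X, ∀ x y, x ≠ y → edgeWeight Q μ x y ≤ C := by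
  have h : ∀ p : X × X, ∃ C : ℝ, ∀ μ ∈ stdSimplex ℝ X, p.1 ≠ p.2 → edgeWeight Q μ p.1 p.2 ≤ C := by
    intro p
    by_cases hp : p.1 = p.2
    · exact ⟨0, fun _ _ h => (h hp).elim⟩
    · obtain ⟨C, hC⟩ := (isCompact_stdSimplex ℝ X).exists_bound_of_continuousOn
        (hQ.continuousOn_edgeWeight hp)
      exact ⟨C, fun μ hμ _ => (le_abs_self _).trans (hC μ hμ)⟩
  choose C hC using h
  refine ⟨1 + ∑ p, |C p|, by positivity, fun μ hμ x y hxy => ?_⟩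
  have := Finset.single_le_sum (f := fun p => |C p|) (fun p _ => abs_nonneg _)
    (Finset.mem_univ (x, y))
  have h2 := hC (x, y) μ hμ hxy
  simp only at h2 this
  linarith [le_abs_self (C (x, y))]

end IsNonlinearMarkovTriple

end EdgeWeight

/-! ### Laplace equations on weighted graphs. -/

section WeightedGraph

variable {X : Type*} [Fintype X] [DecidableEq X]

/-- A weight function is connecting if every cut is crossed by an edge of positive weight. -/
def IsConnecting (L : X → X → ℝ) : Prop :=
  ∀ S : Finset X, S.Nonempty → S ≠ Finset.univ → ∃ x ∈ S, ∃ y ∈ Sᶜ, 0 < L x y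

/-- Flows along edges inside `S` cancel in pairs by antisymmetry. -/
lemma sum_sum_eq_cut {f : X → X → ℝ} (hf : ∀ x y, f y x = -f x y) (S : Finset X) :
    ∑ x ∈ S, ∑ y, f x y = ∑ x ∈ S, ∑ y ∈ Sᶜ, f x y := by
  have h0 : ∑ x ∈ S, ∑ y ∈ S, f x y = 0 := by
    have h := Finset.sum_comm (s := S) (t := S) (f := f)
    have h' : ∑ y ∈ S, ∑ x ∈ S, f x y = -∑ x ∈ S, ∑ y ∈ S, f x y := by
      simp only [← Finset.sum_neg_distrib, ← hf]
    linarith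
  simp only [← Finset.sum_add_sum_compl S, Finset.sum_add_distrib]
  linarith

/-- The oscillation of a potential is controlled by the flow through cuts. -/
theorem sub_le_of_cut_le {L : X → X → ℝ} (hsymm : ∀ x y, L x y = L y x)
    (hL : ∀ x y, x ≠ y → 0 ≤ L x y) (hconn : IsConnecting L) {ψ : X → ℝ} {g : ℝ} (hg : 0 ≤ g)
    (hcut : ∀ S : Finset X,
      |∑ x ∈ S, ∑ y, L x y * (ψ y - ψ x)| ≤ g * ∑ x ∈ S, ∑ y ∈ Sᶜ, L x y) (x y : X) :
    ψ y - ψ x ≤ Fintype.card X * g := by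
  obtain ⟨x₀, -, hx₀⟩ := Finset.exists_min_image Finset.univ ψ ⟨x, Finset.mem_univ x⟩
  -- Sublevel sets at heights spaced by `g`. If `S k = S (k + 1)` is not everything, every edge
  -- leaving it jumps by more than `g`, so the flow through this cut exceeds the assumed bound.
  -- Hence the sets grow strictly until they exhaust `X`, after at most `|X|` levels.
  let S : ℕ → Finset X := fun k => Finset.univ.filter fun z => ψ z ≤ ψ x₀ + k * g
  have hmem : ∀ k z, z ∈ S k ↔ ψ z ≤ ψ x₀ + k * g := fun k z => by simp [S]
  have hmono : ∀ k, S k ⊆ S (k + 1) := by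
    intro k z hz
    rw [hmem] at hz ⊢
    push_cast
    linarith
  have hx₀S : ∀ k, x₀ ∈ S k := fun k => by
    rw [hmem]
    have : 0 ≤ (k : ℝ) * g := by positivity
    linarith
  have hgrow : ∀ k, S k = Finset.univ ∨ k + 1 ≤ (S k).card := by
    intro k
    induction k with
    | zero => exact Or.inr (Finset.card_pos.2 ⟨x₀, hx₀S 0⟩)
    | succ k ih =>
      rcases ih with h | h
      · left
        exact Finset.univ_subset_iff.1 (h ▸ hmono k)
      · by_cases hu : S k = Finset.univ
        · left
          exact Finset.univ_subset_iff.1 (hu ▸ hmono k)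
        right
        have hne : S k ≠ S (k + 1) := by
          intro heq
          obtain ⟨a, ha, b, hb, hab⟩ := hconn (S k) ⟨x₀, hx₀S k⟩ hu
          have hgap : ∀ x ∈ S k, ∀ y ∈ (S k)ᶜ, g < ψ y - ψ x := by
            intro x hx y hy
            rw [heq, Finset.mem_compl, hmem, not_le] at hy
            rw [hmem] at hx
            push_cast at hy
            linarith
          have hne' : ∀ x ∈ S k, ∀ y ∈ (S k)ᶜ, x ≠ y := by
            rintro x hx y hy rfl
            exact Finset.mem_compl.1 hy hx
          have hlt : ∑ x ∈ S k, ∑ y ∈ (S k)ᶜ, L x y * g <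
              ∑ x ∈ S k, ∑ y ∈ (S k)ᶜ, L x y * (ψ y - ψ x) := by
            have hle : ∀ x ∈ S k, ∀ y ∈ (S k)ᶜ, L x y * g ≤ L x y * (ψ y - ψ x) :=
              fun x hx y hy =>
                mul_le_mul_of_nonneg_left (hgap x hx y hy).le (hL x y (hne' x hx y hy))
            refine Finset.sum_lt_sum (fun x hx => Finset.sum_le_sum (hle x hx)) ⟨a, ha, ?_⟩
            exact Finset.sum_lt_sum (hle a ha) ⟨b, hb, mul_lt_mul_of_pos_left (hgap a ha b hb) hab⟩
          have h1 := hcut (S k)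
          rw [sum_sum_eq_cut (f := fun x y => L x y * (ψ y - ψ x))
            (fun x y => by rw [hsymm y x]; ring)] at h1
          simp only [← Finset.sum_mul] at hlt
          linarith [le_abs_self (∑ x ∈ S k, ∑ y ∈ (S k)ᶜ, L x y * (ψ y - ψ x))]
        have := Finset.card_lt_card ((hmono k).ssubset_of_ne hne)
        omega
  have huniv : S (Fintype.card X) = Finset.univ := by
    rcases hgrow (Fintype.card X) with h | h
    · exact h
    · have := Finset.card_le_univ (S (Fintype.card X))
      omega
  have hy : y ∈ S (Fintype.card X) := huniv ▸ Finset.mem_univ y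
  rw [hmem] at hy
  linarith [hx₀ x (Finset.mem_univ x)]

/-- The matrix of `ψ ↦ -∑_y L(x, y) (ψ(y) - ψ(x)) + ∑_y ψ(y)`. -/
def laplaceMatrix (L : X → X → ℝ) : Matrix X X ℝ :=
  Matrix.of fun x y => 1 - (if x = y then 0 else L x y) +
    if x = y then ∑ z, (if x = z then 0 else L x z) else 0

lemma laplaceMatrix_mulVec (L : X → X → ℝ) (ψ : X → ℝ) (x : X) :
    (laplaceMatrix L).mulVec ψ x = (-∑ y, L x y * (ψ y - ψ x)) + ∑ y, ψ y := by
  have h1 : ∀ y, L x y * (ψ y - ψ x) = (if x = y then 0 else L x y) * (ψ y - ψ x) := by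
    intro y
    split_ifs with h
    · simp [h]
    · rfl
  simp only [h1]
  simp only [Matrix.mulVec, dotProduct, laplaceMatrix, Matrix.of_apply, add_mul, sub_mul, one_mul,
    Finset.sum_add_distrib, Finset.sum_sub_distrib, mul_sub]
  simp only [ite_mul, zero_mul, Finset.sum_ite_eq, Finset.mem_univ, if_true, Finset.sum_mul]
  ring

lemma sum_laplace_eq_zero {L : X → X → ℝ} (hsymm : ∀ x y, L x y = L y x) (ψ : X → ℝ) :
    ∑ x, ∑ y, L x y * (ψ y - ψ x) = 0 := by
  rw [sum_sum_eq_cut (f := fun x y => L x y * (ψ y - ψ x)) (fun x y => by rw [hsymm y x]; ring)]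
  simp

/-- Summing a kernel equation over `x` kills the Laplacian, hence `∑ y, ψ y = 0`. Then `ψ` is
harmonic, so constant by `sub_le_of_cut_le` with `g = 0`, so zero. The rank-one term in the matrix
thus removes exactly the constants from the kernel. -/
lemma isUnit_det_laplaceMatrix {L : X → X → ℝ} (hsymm : ∀ x y, L x y = L y x)
    (hL : ∀ x y, x ≠ y → 0 ≤ L x y) (hconn : IsConnecting L) : IsUnit (laplaceMatrix L).det := by
  rw [isUnit_iff_ne_zero]
  intro hdet
  obtain ⟨ψ, hψ, h0⟩ := Matrix.exists_mulVec_eq_zero_iff.2 hdet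
  have h1 : ∀ x, (-∑ y, L x y * (ψ y - ψ x)) + ∑ y, ψ y = 0 := fun x => by
    rw [← laplaceMatrix_mulVec, h0]; rfl
  obtain ⟨x₁, hx₁⟩ := Function.ne_iff.1 hψ
  have hcard : 0 < (Fintype.card X : ℝ) := by
    exact_mod_cast Fintype.card_pos_iff.2 ⟨x₁⟩
  have hsum : ∑ y, ψ y = 0 := by
    have h2 : ∑ x, ((-∑ y, L x y * (ψ y - ψ x)) + ∑ y, ψ y) = 0 :=
      Finset.sum_eq_zero fun x _ => h1 x
    rw [Finset.sum_add_distrib, Finset.sum_neg_distrib, sum_laplace_eq_zero hsymm,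
      Finset.sum_const, Finset.card_univ, nsmul_eq_mul] at h2
    have : (Fintype.card X : ℝ) * ∑ y, ψ y = 0 := by linarith
    exact (mul_eq_zero.1 this).resolve_left hcard.ne'
  have hlap : ∀ x, ∑ y, L x y * (ψ y - ψ x) = 0 := fun x => by
    have := h1 x
    rw [hsum] at this
    linarith
  have hosc := sub_le_of_cut_le hsymm hL hconn (ψ := ψ) le_rfl (fun S => by simp [hlap])
  simp only [mul_zero] at hosc
  have hconst : ∀ y, ψ y = ψ x₁ := fun y => le_antisymm (by linarith [hosc x₁ y])
    (by linarith [hosc y x₁])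
  simp only [hconst, Finset.sum_const, Finset.card_univ, nsmul_eq_mul] at hsum
  exact hx₁ ((mul_eq_zero.1 hsum).resolve_left hcard.ne')

/-- The solution of `-∑_y L(x, y) (ψ(y) - ψ(x)) = v(x)` with zero mean. -/
def laplaceSolution (L : X → X → ℝ) (v : X → ℝ) : X → ℝ :=
  (laplaceMatrix L)⁻¹.mulVec v

theorem laplaceSolution_spec {L : X → X → ℝ} (hsymm : ∀ x y, L x y = L y x)
    (hL : ∀ x y, x ≠ y → 0 ≤ L x y) (hconn : IsConnecting L) {v : X → ℝ} (hv : ∑ x, v x = 0)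
    (x : X) : -∑ y, L x y * (laplaceSolution L v y - laplaceSolution L v x) = v x := by
  set ψ := laplaceSolution L v with hψdef
  have hmul : (laplaceMatrix L).mulVec ψ = v := by
    rw [hψdef, laplaceSolution, Matrix.mulVec_mulVec,
      Matrix.mul_nonsing_inv _ (isUnit_det_laplaceMatrix hsymm hL hconn), Matrix.one_mulVec]
  have h1 : ∀ x, (-∑ y, L x y * (ψ y - ψ x)) + ∑ y, ψ y = v x := fun x => by
    rw [← laplaceMatrix_mulVec, hmul]
  have hcard : 0 < (Fintype.card X : ℝ) := by
    exact_mod_cast Fintype.card_pos_iff.2 ⟨x⟩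
  have hsum : ∑ y, ψ y = 0 := by
    have h2 : ∑ x, ((-∑ y, L x y * (ψ y - ψ x)) + ∑ y, ψ y) = 0 := by simp only [h1, hv]
    rw [Finset.sum_add_distrib, Finset.sum_neg_distrib, sum_laplace_eq_zero hsymm,
      Finset.sum_const, Finset.card_univ, nsmul_eq_mul] at h2
    have : (Fintype.card X : ℝ) * ∑ y, ψ y = 0 := by linarith
    exact (mul_eq_zero.1 this).resolve_left hcard.ne'
  rw [← h1 x, hsum, add_zero]

theorem abs_laplaceSolution_sub_le {L : X → X → ℝ} (hsymm : ∀ x y, L x y = L y x)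
    (hL : ∀ x y, x ≠ y → 0 ≤ L x y) (hconn : IsConnecting L) {v : X → ℝ} (hv : ∑ x, v x = 0)
    {g : ℝ} (hg : 0 ≤ g)
    (hcut : ∀ S : Finset X, |∑ x ∈ S, v x| ≤ g * ∑ x ∈ S, ∑ y ∈ Sᶜ, L x y) (x y : X) :
    |laplaceSolution L v y - laplaceSolution L v x| ≤ Fintype.card X * g := by
  have h := sub_le_of_cut_le hsymm hL hconn (ψ := laplaceSolution L v) hg fun S => by
    have h1 : ∑ x ∈ S, ∑ y, L x y * (laplaceSolution L v y - laplaceSolution L v x) =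
        -∑ x ∈ S, v x := by
      rw [← Finset.sum_neg_distrib]
      refine Finset.sum_congr rfl fun x _ => ?_
      rw [← laplaceSolution_spec hsymm hL hconn hv x, neg_neg]
    rw [h1, abs_neg]
    exact hcut S
  rw [abs_le]
  constructor
  · linarith [h y x]
  · exact h x y

lemma laplaceSolution_sum_eq_zero {L : X → X → ℝ} (hsymm : ∀ x y, L x y = L y x)
    (hL : ∀ x y, x ≠ y → 0 ≤ L x y) (hconn : IsConnecting L) {v : X → ℝ} (hv : ∑ x, v x = 0) :
    ∑ x, laplaceSolution L v x = 0 := by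
  rcases isEmpty_or_nonempty X with hX | ⟨⟨x⟩⟩
  · simp
  have hmul : (laplaceMatrix L).mulVec (laplaceSolution L v) = v := by
    rw [laplaceSolution, Matrix.mulVec_mulVec,
      Matrix.mul_nonsing_inv _ (isUnit_det_laplaceMatrix hsymm hL hconn), Matrix.one_mulVec]
  have h1 := laplaceMatrix_mulVec L (laplaceSolution L v) x
  rw [hmul, laplaceSolution_spec hsymm hL hconn hv x] at h1
  linarith

/-- With zero mean, `|X| ψ x` is minus the sum of the differences `ψ y - ψ x`, so the oscillation
bound becomes a pointwise bound. -/
lemma abs_laplaceSolution_le {L : X → X → ℝ} (hsymm : ∀ x y, L x y = L y x)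
    (hL : ∀ x y, x ≠ y → 0 ≤ L x y) (hconn : IsConnecting L) {v : X → ℝ} (hv : ∑ x, v x = 0)
    {g : ℝ} (hg : 0 ≤ g)
    (hcut : ∀ S : Finset X, |∑ x ∈ S, v x| ≤ g * ∑ x ∈ S, ∑ y ∈ Sᶜ, L x y) (x : X) :
    |laplaceSolution L v x| ≤ Fintype.card X * g := by
  set ψ := laplaceSolution L v with hψ
  have hcard : 0 < (Fintype.card X : ℝ) := by
    exact_mod_cast Fintype.card_pos_iff.2 ⟨x⟩
  have h : (Fintype.card X : ℝ) * ψ x = -∑ y, (ψ y - ψ x) := by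
    rw [Finset.sum_sub_distrib, hψ, laplaceSolution_sum_eq_zero hsymm hL hconn hv]
    simp
  have h2 : (Fintype.card X : ℝ) * |ψ x| ≤ Fintype.card X * (Fintype.card X * g) := by
    rw [← abs_of_pos hcard, ← abs_mul, h, abs_neg, abs_of_pos hcard]
    refine (Finset.abs_sum_le_sum_abs _ _).trans ?_
    refine (Finset.sum_le_sum fun y _ =>
      abs_laplaceSolution_sub_le hsymm hL hconn hv hg hcut x y).trans ?_
    simp
  exact le_of_mul_le_mul_left h2 hcard

/-- The inverse is the adjugate divided by the determinant, both polynomial in the entries. Only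
off-diagonal weights need be continuous, since `laplaceMatrix` discards the diagonal of `L`. -/
lemma continuousOn_laplaceSolution {T : Set ℝ} {L : ℝ → X → X → ℝ} {v : ℝ → X → ℝ}
    (hLc : ∀ x y, x ≠ y → ContinuousOn (fun t => L t x y) T)
    (hvc : ∀ x, ContinuousOn (fun t => v t x) T)
    (hdet : ∀ t ∈ T, IsUnit (laplaceMatrix (L t)).det) (x : X) :
    ContinuousOn (fun t => laplaceSolution (L t) (v t) x) T := by
  have hM : ContinuousOn (fun t => laplaceMatrix (L t)) T := by
    refine continuousOn_pi.2 fun x => continuousOn_pi.2 fun y => ?_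
    have hite : ∀ a b, ContinuousOn (fun t => if a = b then (0 : ℝ) else L t a b) T := by
      intro a b
      split_ifs with h
      · exact continuousOn_const
      · exact hLc a b h
    simp only [laplaceMatrix, Matrix.of_apply]
    refine (continuousOn_const.sub (hite x y)).add ?_
    split_ifs
    · exact continuousOn_finsetSum _ fun z _ => hite x z
    · exact continuousOn_const
  have hdetc : ContinuousOn (fun t => (laplaceMatrix (L t)).det) T :=
    (continuous_id.matrix_det).comp_continuousOn hM
  have hadj : ContinuousOn (fun t => (laplaceMatrix (L t)).adjugate) T :=
    (continuous_id.matrix_adjugate).comp_continuousOn hM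
  simp only [laplaceSolution, Matrix.inv_def, Ring.inverse_eq_inv', Matrix.mulVec, dotProduct,
    Matrix.smul_apply, smul_eq_mul]
  refine continuousOn_finsetSum _ fun y _ => ((hdetc.inv₀ fun t ht => (hdet t ht).ne_zero).mul
    ?_).mul (hvc y)
  exact ((continuous_apply y).comp (continuous_apply x)).comp_continuousOn hadj

end WeightedGraph

/-! ### Weak derivatives on the unit interval. -/

section WeakDerivative

/-- As `v` is merely integrable, its primitive is absolutely continuous and differentiable only
almost everywhere; integration by parts for absolutely continuous functions still applies. -/
lemma setIntegral_deriv_mul_primitive {φ v : ℝ → ℝ} (hφ : ContDiff ℝ ∞ φ)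
    (hφs : tsupport φ ⊆ Ioo 0 1) (hv : IntegrableOn v (Icc 0 1)) :
    ∫ t in Ioo (0 : ℝ) 1, deriv φ t * ∫ r in (0 : ℝ)..t, v r = -∫ t in Ioo (0 : ℝ) 1, φ t * v t := by
  have hvi : IntervalIntegrable v volume 0 1 :=
    (intervalIntegrable_iff_integrableOn_Icc_of_le zero_le_one).2 hv
  have hφac : AbsolutelyContinuousOnInterval φ 0 1 :=
    ((hφ.of_le (by norm_cast)).contDiffOn (n := 1)).absolutelyContinuousOnInterval
  have hVac := hvi.absolutelyContinuousOnInterval_intervalIntegral (c := 0) (by simp)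
  have hb : ∀ t ∉ Ioo (0 : ℝ) 1, φ t = 0 := fun t ht =>
    image_eq_zero_of_notMem_tsupport fun h => ht (hφs h)
  have h := hφac.integral_mul_deriv_eq_deriv_mul hVac
  rw [hb 0 (by simp), hb 1 (by simp), zero_mul, zero_mul, sub_zero, zero_sub] at h
  have hae : ∫ x in (0 : ℝ)..1, φ x * deriv (fun x => ∫ r in (0 : ℝ)..x, v r) x =
      ∫ x in (0 : ℝ)..1, φ x * v x := by
    refine intervalIntegral.integral_congr_ae ?_
    filter_upwards [hvi.ae_hasDerivAt_integral] with x hx hmem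
    rw [(hx (uIoc_subset_uIcc hmem) 0 (by simp)).deriv]
  rw [hae] at h
  simp only [intervalIntegral.integral_of_le zero_le_one, integral_Ioc_eq_integral_Ioo] at h
  linarith

/-- A smooth compactly supported function of vanishing integral has a compactly supported
primitive. -/
lemma exists_primitive_tsupport_subset {g : ℝ → ℝ} (hg : ContDiff ℝ ∞ g)
    {α β : ℝ} (hα : 0 < α) (hβ : β < 1)
    (hsupp : ∀ t ∉ Icc α β, g t = 0) (hint : ∫ t in (0 : ℝ)..1, g t = 0) :
    ∃ φ : ℝ → ℝ, ContDiff ℝ ∞ φ ∧ HasCompactSupport φ ∧ tsupport φ ⊆ Ioo 0 1 ∧ deriv φ = g := by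
  have hd : ∀ t, HasDerivAt (fun t => ∫ r in (0 : ℝ)..t, g r) (g t) t := fun t =>
    intervalIntegral.integral_hasDerivAt_right (hg.continuous.intervalIntegrable _ _)
      (hg.continuous.stronglyMeasurableAtFilter _ _) hg.continuous.continuousAt
  have hderiv : deriv (fun t => ∫ r in (0 : ℝ)..t, g r) = g := funext fun t => (hd t).deriv
  have hzero : ∀ t ∉ Icc α β, ∫ r in (0 : ℝ)..t, g r = 0 := by
    intro t ht
    rcases lt_or_ge t α with h | h
    · rw [intervalIntegral.integral_congr (g := fun _ => 0), intervalIntegral.integral_zero]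
      intro r hr
      refine hsupp r fun hr' => ?_
      have := hr.2
      have h2 := le_max_iff.1 this
      rcases h2 with h2 | h2 <;> linarith [hr'.1]
    · have hβt : β < t := not_le.1 fun h' => ht ⟨h, h'⟩
      have hsplit := intervalIntegral.integral_add_adjacent_intervals (a := 0) (b := t) (c := 1)
        (hg.continuous.intervalIntegrable (μ := volume) _ _) (hg.continuous.intervalIntegrable _ _)
      rw [intervalIntegral.integral_congr (a := t) (g := fun _ => 0),
        intervalIntegral.integral_zero, hint] at hsplit
      · linarith
      · intro r hr
        refine hsupp r fun hr' => ?_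
        have h2 := min_le_iff.1 hr.1
        rcases h2 with h2 | h2 <;> linarith [hr'.2]
  have hsub : tsupport (fun t => ∫ r in (0 : ℝ)..t, g r) ⊆ Icc α β :=
    closure_minimal (fun t ht => by_contra fun h => ht (hzero t h)) isClosed_Icc
  refine ⟨fun t => ∫ r in (0 : ℝ)..t, g r, ?_, ?_, ?_, hderiv⟩
  · rw [contDiff_infty_iff_deriv, hderiv]
    exact ⟨fun t => (hd t).differentiableAt, hg⟩
  · exact HasCompactSupport.of_support_subset_isCompact isCompact_Icc
      (subset_closure.trans hsub)
  · exact hsub.trans fun t ht => ⟨hα.trans_le ht.1, ht.2.trans_lt hβ⟩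

/-- The lemma of du Bois-Reymond. -/
lemma eq_left_of_forall_integral_deriv_mul_eq_zero {h : ℝ → ℝ} (hh : ContinuousOn h (Icc 0 1))
    (H : ∀ φ : ℝ → ℝ, ContDiff ℝ ∞ φ → HasCompactSupport φ → tsupport φ ⊆ Ioo 0 1 →
      ∫ t in Ioo (0 : ℝ) 1, deriv φ t * h t = 0) :
    ∀ t ∈ Icc (0 : ℝ) 1, h t = h 0 := by
  -- The function `e` built from this bump has integral one and is supported in `[1/4, 3/4]`.
  let η : ContDiffBump (1 / 2 : ℝ) := ⟨1 / 8, 1 / 4, by norm_num, by norm_num⟩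
  set e : ℝ → ℝ := η.normed volume with he
  have heC : ContDiff ℝ ∞ e := η.contDiff_normed
  have hes : tsupport e = Icc (1 / 4) (3 / 4) := by
    rw [he, η.tsupport_normed_eq, Real.closedBall_eq_Icc]
    norm_num [η]
  have hint_sub : ∀ f : ℝ → ℝ, (∀ t ∉ Ioo (0 : ℝ) 1, f t = 0) →
      ∫ t, f t = ∫ t in (0 : ℝ)..1, f t := by
    intro f hf
    rw [intervalIntegral.integral_of_le zero_le_one, integral_Ioc_eq_integral_Ioo,
      setIntegral_eq_integral_of_forall_compl_eq_zero hf]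
  have hez : ∀ t ∉ Ioo (0 : ℝ) 1, e t = 0 := fun t ht =>
    image_eq_zero_of_notMem_tsupport fun h' => ht (by
      rw [hes] at h'
      exact ⟨by linarith [h'.1], by linarith [h'.2]⟩)
  have heint : ∫ t in (0 : ℝ)..1, e t = 1 := by
    rw [← hint_sub e hez]
    exact η.integral_normed
  have hio : IntegrableOn h (Ioo 0 1) := (hh.integrableOn_Icc).mono_set Ioo_subset_Icc_self
  have hmulint : ∀ f : ℝ → ℝ, Continuous f → IntegrableOn (fun t => f t * h t) (Ioo 0 1) :=
    fun f hf => ((hf.continuousOn.mul hh).integrableOn_Icc).mono_set Ioo_subset_Icc_self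
  set c : ℝ := ∫ t in Ioo (0 : ℝ) 1, e t * h t with hc
  have key : ∀ᵐ t, t ∈ Ioo (0 : ℝ) 1 → h t - c = 0 := by
    refine isOpen_Ioo.ae_eq_zero_of_integral_contDiff_smul_eq_zero
      (f := fun t => h t - c) ((hio.sub (integrableOn_const (by simp))).locallyIntegrableOn) ?_
    intro g hg hgc hgs
    have hgz : ∀ t ∉ Ioo (0 : ℝ) 1, g t = 0 := fun t ht =>
      image_eq_zero_of_notMem_tsupport fun h' => ht (hgs h')
    set m : ℝ := ∫ t in (0 : ℝ)..1, g t with hm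
    have hK : IsCompact (tsupport g ∪ Icc (1 / 4 : ℝ) (3 / 4)) := hgc.isCompact.union isCompact_Icc
    have hKne : (tsupport g ∪ Icc (1 / 4 : ℝ) (3 / 4)).Nonempty :=
      ⟨1 / 2, Or.inr ⟨by norm_num, by norm_num⟩⟩
    have hKsub : tsupport g ∪ Icc (1 / 4 : ℝ) (3 / 4) ⊆ Ioo 0 1 := by
      refine union_subset hgs fun t ht => ⟨by linarith [ht.1], by linarith [ht.2]⟩
    obtain ⟨α, hα⟩ := hK.exists_isLeast hKne
    obtain ⟨β, hβ⟩ := hK.exists_isGreatest hKne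
    -- Subtracting `m * e` makes the integral of `g` vanish, so `g - m * e` is the derivative of a
    -- test function. The hypothesis then reads `∫ g h = m c`, that is, `∫ g (h - c) = 0`.
    have hG : ContDiff ℝ ∞ (fun t => g t - m * e t) := hg.sub (contDiff_const.mul heC)
    have hme : IntervalIntegrable (fun t => m * e t) volume 0 1 :=
      (continuous_const.mul heC.continuous).intervalIntegrable _ _
    obtain ⟨φ, hφ, hφc, hφs, hφd⟩ := exists_primitive_tsupport_subset hG
      (hKsub hα.1).1 (hKsub hβ.1).2
      (fun t ht => by
        have h1 : t ∉ tsupport g ∪ Icc (1 / 4 : ℝ) (3 / 4) := fun h' => ht ⟨hα.2 h', hβ.2 h'⟩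
        rw [image_eq_zero_of_notMem_tsupport fun h' => h1 (Or.inl h'),
          image_eq_zero_of_notMem_tsupport fun h' => h1 (Or.inr (hes ▸ h'))]
        simp)
      (by
        rw [intervalIntegral.integral_sub (hg.continuous.intervalIntegrable _ _)
          hme,
          intervalIntegral.integral_const_mul, heint, ← hm]
        ring)
    have h0 := H φ hφ hφc hφs
    rw [hφd] at h0
    have h1 : ∫ t in Ioo (0 : ℝ) 1, (g t - m * e t) * h t =
        (∫ t in Ioo (0 : ℝ) 1, g t * h t) - m * c := by
      rw [hc, ← integral_const_mul, ← integral_sub (hmulint g hg.continuous)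
        ((hmulint e heC.continuous).const_mul m)]
      refine integral_congr_ae (Eventually.of_forall fun t => ?_)
      ring
    have h2 : ∫ t, g t • (h t - c) = ∫ t in Ioo (0 : ℝ) 1, g t * (h t - c) :=
      (setIntegral_eq_integral_of_forall_compl_eq_zero fun t ht => by simp [hgz t ht]).symm
    have h3 : ∫ t in Ioo (0 : ℝ) 1, g t * (h t - c) =
        (∫ t in Ioo (0 : ℝ) 1, g t * h t) - m * c := by
      have hm' : m = ∫ t in Ioo (0 : ℝ) 1, g t := by
        rw [hm, intervalIntegral.integral_of_le zero_le_one, integral_Ioc_eq_integral_Ioo]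
      rw [hm', ← integral_mul_const, ← integral_sub (hmulint g hg.continuous)]
      · refine integral_congr_ae (Eventually.of_forall fun t => ?_)
        ring
      · exact ((hg.continuous.continuousOn.integrableOn_Icc).mono_set
          Ioo_subset_Icc_self).mul_const c
    rw [h2, h3, ← h1, h0]
  have hIoo : EqOn h (fun _ => c) (Ioo 0 1) := by
    have hae : h =ᵐ[volume.restrict (Ioo 0 1)] fun _ => c := by
      rw [EventuallyEq, ae_restrict_iff' measurableSet_Ioo]
      filter_upwards [key] with t ht hmem
      linarith [ht hmem]
    exact Measure.eqOn_open_of_ae_eq hae isOpen_Ioo (hh.mono Ioo_subset_Icc_self)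
      continuousOn_const
  have hIcc : EqOn h (fun _ => c) (Icc 0 1) :=
    hIoo.of_subset_closure hh continuousOn_const Ioo_subset_Icc_self (by
      rw [closure_Ioo (zero_ne_one)])
  intro t ht
  rw [hIcc ht, hIcc ⟨le_rfl, zero_le_one⟩]

/-- A continuous function has weak derivative `v` iff it is a primitive of `v`. -/
theorem weak_derivative_iff {u v : ℝ → ℝ} (hu : ContinuousOn u (Icc 0 1))
    (hv : IntegrableOn v (Icc 0 1)) :
    (∀ φ : ℝ → ℝ, ContDiff ℝ ∞ φ → HasCompactSupport φ → tsupport φ ⊆ Ioo 0 1 →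
      ∫ t in Ioo (0 : ℝ) 1, deriv φ t * u t = -∫ t in Ioo (0 : ℝ) 1, φ t * v t) ↔
    ∀ t ∈ Icc (0 : ℝ) 1, u t = u 0 + ∫ r in (0 : ℝ)..t, v r := by
  have hV : ContinuousOn (fun t => ∫ r in (0 : ℝ)..t, v r) (Icc 0 1) :=
    intervalIntegral.continuousOn_primitive_interval (by rwa [uIcc_of_le zero_le_one])
      |>.mono (by rw [uIcc_of_le zero_le_one])
  have hder : ∀ φ : ℝ → ℝ, ContDiff ℝ ∞ φ → Continuous (deriv φ) := fun φ hφ =>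
    hφ.continuous_deriv (by norm_cast)
  have hmulint : ∀ f : ℝ → ℝ, Continuous f → ∀ w : ℝ → ℝ, ContinuousOn w (Icc 0 1) →
      IntegrableOn (fun t => f t * w t) (Ioo 0 1) :=
    fun f hf w hw => ((hf.continuousOn.mul hw).integrableOn_Icc).mono_set Ioo_subset_Icc_self
  constructor
  · intro H t ht
    have h := eq_left_of_forall_integral_deriv_mul_eq_zero
      (h := fun t => u t - ∫ r in (0 : ℝ)..t, v r) (hu.sub hV) (fun φ hφ hφc hφs => by
      simp only [mul_sub]
      rw [integral_sub (hmulint _ (hder φ hφ) _ hu) (hmulint _ (hder φ hφ) _ hV),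
        H φ hφ hφc hφs, setIntegral_deriv_mul_primitive hφ hφs hv, sub_self]) t ht
    simp only [intervalIntegral.integral_same] at h
    linarith
  · intro H φ hφ hφc hφs
    have h1 : ∫ t in Ioo (0 : ℝ) 1, deriv φ t * u t =
        ∫ t in Ioo (0 : ℝ) 1, (deriv φ t * u 0 + deriv φ t * ∫ r in (0 : ℝ)..t, v r) := by
      refine setIntegral_congr_fun measurableSet_Ioo fun t ht => ?_
      rw [H t (Ioo_subset_Icc_self ht)]
      ring
    have h2 : ∫ t in Ioo (0 : ℝ) 1, deriv φ t * u 0 = 0 := by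
      rw [integral_mul_const, ← integral_Ioc_eq_integral_Ioo,
        ← intervalIntegral.integral_of_le zero_le_one, intervalIntegral.integral_deriv_eq_sub
        (fun x _ => (hφ.differentiable (by simp)).differentiableAt)
        ((hder φ hφ).intervalIntegrable _ _)]
      have hb : ∀ t ∉ Ioo (0 : ℝ) 1, φ t = 0 := fun t ht =>
        image_eq_zero_of_notMem_tsupport fun h => ht (hφs h)
      rw [hb 0 (by simp), hb 1 (by simp)]
      simp
    rw [h1, integral_add (hmulint _ (hder φ hφ) _ continuousOn_const)
      (hmulint _ (hder φ hφ) _ hV), h2, zero_add, setIntegral_deriv_mul_primitive hφ hφs hv]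

end WeakDerivative

/-! ### Paths in integrated form: rescaling, concatenation, energy. -/

section Paths

variable {X : Type*} [Fintype X]

/-- Solutions of the continuity equation on `[a, b]`, in integrated form. -/
structure IsPath (Q : (X → ℝ) → X → X → ℝ) (a b : ℝ) (μ ψ : ℝ → X → ℝ) : Prop where
  continuousOn : ContinuousOn μ (Icc a b)
  mem_simplex : ∀ t ∈ Icc a b, μ t ∈ stdSimplex ℝ X
  integrable : ∀ x, IntegrableOn (fun t => ψ t x) (Icc a b)
  increment : ∀ s ∈ Icc a b, ∀ t ∈ Icc a b, ∀ x,
    μ t x - μ s x = ∫ r in s..t, onsager Q (μ r) (ψ r) x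

/-- The energy `∫ₐᵇ 𝒜(μₜ, ψₜ) dt` of a curve. -/
def energy (Q : (X → ℝ) → X → X → ℝ) (a b : ℝ) (μ ψ : ℝ → X → ℝ) : ℝ≥0∞ :=
  ∫⁻ t in Icc a b, ENNReal.ofReal (action Q (μ t) (ψ t))

lemma onsager_smul (Q : (X → ℝ) → X → X → ℝ) (μ ψ : X → ℝ) (c : ℝ) (x : X) :
    onsager Q μ (c • ψ) x = c * onsager Q μ ψ x := by
  simp only [onsager, Pi.smul_apply, smul_eq_mul, mul_neg, Finset.mul_sum]
  congr 1
  exact Finset.sum_congr rfl fun y _ => by ring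

lemma action_smul (Q : (X → ℝ) → X → X → ℝ) (μ ψ : X → ℝ) (c : ℝ) :
    action Q μ (c • ψ) = c ^ 2 * action Q μ ψ := by
  simp only [action, Pi.smul_apply, smul_eq_mul, Finset.mul_sum]
  exact Finset.sum_congr rfl fun x _ => Finset.sum_congr rfl fun y _ => by ring

/-- The pairing of a function with the Onsager operator, as a Dirichlet form. -/
lemma sum_mul_onsager (Q : (X → ℝ) → X → X → ℝ) (μ ψ D : X → ℝ) :
    ∑ x, D x * onsager Q μ ψ x =
      (1 / 2) * ∑ x, ∑ y, (D y - D x) * (ψ y - ψ x) * edgeWeight Q μ x y := by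
  have h1 : ∑ x, D x * onsager Q μ ψ x = -∑ x, ∑ y, D x * (ψ y - ψ x) * edgeWeight Q μ x y := by
    simp only [onsager, mul_neg, Finset.mul_sum, Finset.sum_neg_distrib]
    congr 1
    exact Finset.sum_congr rfl fun x _ => Finset.sum_congr rfl fun y _ => by ring
  have h2 : ∑ x, ∑ y, D x * (ψ y - ψ x) * edgeWeight Q μ x y =
      -∑ x, ∑ y, D y * (ψ y - ψ x) * edgeWeight Q μ x y := by
    rw [Finset.sum_comm]
    simp only [← Finset.sum_neg_distrib]
    refine Finset.sum_congr rfl fun x _ => Finset.sum_congr rfl fun y _ => ?_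
    rw [edgeWeight_comm Q μ y x]
    ring
  have h3 : ∑ x, ∑ y, (D y - D x) * (ψ y - ψ x) * edgeWeight Q μ x y =
      ∑ x, ∑ y, D y * (ψ y - ψ x) * edgeWeight Q μ x y -
        ∑ x, ∑ y, D x * (ψ y - ψ x) * edgeWeight Q μ x y := by
    simp only [← Finset.sum_sub_distrib]
    exact Finset.sum_congr rfl fun x _ => Finset.sum_congr rfl fun y _ => by ring
  rw [h3, h1]
  linarith

variable [DecidableEq X] {K : (X → ℝ) → X → ℝ} {Q : (X → ℝ) → X → X → ℝ}

lemma IsNonlinearMarkovTriple.action_nonneg (hQ : IsNonlinearMarkovTriple K Q) {μ : X → ℝ}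
    (hμ : μ ∈ stdSimplex ℝ X) (ψ : X → ℝ) : 0 ≤ action Q μ ψ := by
  refine mul_nonneg (by norm_num) (Finset.sum_nonneg fun x _ => Finset.sum_nonneg fun y _ => ?_)
  by_cases hxy : x = y
  · simp [hxy]
  · exact mul_nonneg (sq_nonneg _) (hQ.edgeWeight_nonneg hμ hxy)

/-- Cauchy–Schwarz for the Dirichlet form, stated as Young's inequality with a free parameter `l`:
this version integrates in time without square roots. -/
lemma IsNonlinearMarkovTriple.abs_sum_mul_onsager_le (hQ : IsNonlinearMarkovTriple K Q) {μ : X → ℝ}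
    (hμ : μ ∈ stdSimplex ℝ X) (ψ D : X → ℝ) {l : ℝ} (hl : 0 < l) :
    |∑ x, D x * onsager Q μ ψ x| ≤ (1 / 2) * (l * action Q μ D + l⁻¹ * action Q μ ψ) := by
  have h : ∀ ε : ℝ, ε = 1 ∨ ε = -1 → ε * ∑ x, D x * onsager Q μ ψ x ≤
      (1 / 2) * (l * action Q μ D + l⁻¹ * action Q μ ψ) := by
    intro ε hε
    have h2 : (1 / 2) * (l * action Q μ D + l⁻¹ * action Q μ ψ) =
        (1 / 2) * ∑ x, ∑ y, (1 / 2) * (l * (D y - D x) ^ 2 + l⁻¹ * (ψ y - ψ x) ^ 2) *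
          edgeWeight Q μ x y := by
      simp only [action, Finset.mul_sum, ← Finset.sum_add_distrib]
      exact Finset.sum_congr rfl fun x _ => Finset.sum_congr rfl fun y _ => by ring
    rw [sum_mul_onsager, h2, mul_left_comm]
    refine mul_le_mul_of_nonneg_left ?_ (by norm_num)
    rw [Finset.mul_sum]
    refine Finset.sum_le_sum fun x _ => ?_
    rw [Finset.mul_sum]
    refine Finset.sum_le_sum fun y _ => ?_
    by_cases hxy : x = y
    · simp [hxy]
    · rw [← mul_assoc]
      refine mul_le_mul_of_nonneg_right ?_ (hQ.edgeWeight_nonneg hμ hxy)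
      have h3 : 0 ≤ l⁻¹ * (l * (D y - D x) - ε * (ψ y - ψ x)) ^ 2 := by positivity
      have h4 : ε ^ 2 = 1 := by rcases hε with rfl | rfl <;> norm_num
      have h5 : l⁻¹ * l = 1 := inv_mul_cancel₀ hl.ne'
      have h6 : l⁻¹ * (l * (D y - D x) - ε * (ψ y - ψ x)) ^ 2 =
          (l⁻¹ * l) * l * (D y - D x) ^ 2 - 2 * (l⁻¹ * l) * ε * (D y - D x) * (ψ y - ψ x) +
            l⁻¹ * ε ^ 2 * (ψ y - ψ x) ^ 2 := by ring
      rw [h6, h4, h5] at h3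
      linarith
  rw [abs_le]
  constructor
  · linarith [h (-1) (Or.inr rfl)]
  · linarith [h 1 (Or.inl rfl)]

lemma IsNonlinearMarkovTriple.integrableOn_onsager (hQ : IsNonlinearMarkovTriple K Q) {a b : ℝ}
    {μ ψ : ℝ → X → ℝ} (hμ : ContinuousOn μ (Icc a b)) (hs : ∀ t ∈ Icc a b, μ t ∈ stdSimplex ℝ X)
    (hψ : ∀ x, IntegrableOn (fun t => ψ t x) (Icc a b)) (x : X) :
    IntegrableOn (fun t => onsager Q (μ t) (ψ t) x) (Icc a b) := by
  refine Integrable.neg (f := fun t => ∑ y, edgeWeight Q (μ t) x y * (ψ t y - ψ t x)) ?_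
  refine integrable_finsetSum _ fun y _ => ?_
  by_cases hxy : x = y
  · simp [hxy]
  · exact IntegrableOn.continuousOn_mul ((hQ.continuousOn_edgeWeight hxy).comp hμ hs)
      ((hψ y).sub (hψ x)) isCompact_Icc

lemma IsNonlinearMarkovTriple.isPath_of_increment (hQ : IsNonlinearMarkovTriple K Q) {a b : ℝ}
    {μ ψ : ℝ → X → ℝ} (hμ : ContinuousOn μ (Icc a b)) (hs : ∀ t ∈ Icc a b, μ t ∈ stdSimplex ℝ X)
    (hψ : ∀ x, IntegrableOn (fun t => ψ t x) (Icc a b))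
    (hinc : ∀ t ∈ Icc a b, ∀ x, μ t x = μ a x + ∫ r in a..t, onsager Q (μ r) (ψ r) x) :
    IsPath Q a b μ ψ := by
  refine ⟨hμ, hs, hψ, fun s hs' t ht' x => ?_⟩
  have hint : ∀ r ∈ Icc a b, IntervalIntegrable (fun r => onsager Q (μ r) (ψ r) x) volume a r :=
    fun r hr => (intervalIntegrable_iff_integrableOn_Icc_of_le hr.1).2
      ((hQ.integrableOn_onsager hμ hs hψ x).mono_set (Icc_subset_Icc_right hr.2))
  rw [hinc t ht', hinc s hs', add_sub_add_left_eq_sub,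
    intervalIntegral.integral_interval_sub_left (hint t ht') (hint s hs')]

/-- Replaces the distributional equation by its integrated form, which can be restricted, rescaled
and concatenated directly. -/
lemma IsNonlinearMarkovTriple.isCESolution_iff (hQ : IsNonlinearMarkovTriple K Q)
    {μ₀ μ₁ : X → ℝ} {μ ψ : ℝ → X → ℝ} :
    IsCESolution Q μ₀ μ₁ μ ψ ↔ IsPath Q 0 1 μ ψ ∧ μ 0 = μ₀ ∧ μ 1 = μ₁ := by
  constructor
  · intro h
    refine ⟨hQ.isPath_of_increment h.continuousOn h.mem_simplex h.integrable fun t ht x => ?_,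
      h.left_eq, h.right_eq⟩
    exact (weak_derivative_iff ((continuous_apply x).comp_continuousOn h.continuousOn)
      (hQ.integrableOn_onsager h.continuousOn h.mem_simplex h.integrable x)).1
      (fun φ h1 h2 h3 => h.weak_equation φ h1 h2 h3 x) t ht
  · rintro ⟨h, h0, h1⟩
    refine ⟨h.continuousOn, h.mem_simplex, h0, h1, h.integrable, fun φ hφ1 hφ2 hφ3 x => ?_⟩
    refine (weak_derivative_iff ((continuous_apply x).comp_continuousOn h.continuousOn)
      (hQ.integrableOn_onsager h.continuousOn h.mem_simplex h.integrable x)).2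
      (fun t ht => ?_) φ hφ1 hφ2 hφ3
    have := h.increment 0 ⟨le_rfl, zero_le_one⟩ t ht x
    simp only [Function.comp_apply]
    linarith

omit [DecidableEq X] in
-- Negative `q` is allowed, so that time reversal is included.
lemma IsPath.comp_affine {a b c d p q : ℝ} {μ ψ : ℝ → X → ℝ} (h : IsPath Q a b μ ψ) (hq : q ≠ 0)
    (hmap : ∀ r ∈ Icc c d, p + q * r ∈ Icc a b) :
    IsPath Q c d (fun r => μ (p + q * r)) (fun r => q • ψ (p + q * r)) := by
  refine ⟨h.continuousOn.comp (by fun_prop) hmap, fun t ht => h.mem_simplex _ (hmap t ht),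
    fun x => ?_, fun s hs t ht x => ?_⟩
  · have himg : (fun r => p + q * r) '' Icc c d ⊆ Icc a b := image_subset_iff.2 hmap
    have h1 := (integrableOn_image_iff_integrableOn_abs_deriv_smul (f := fun r => p + q * r)
      (f' := fun _ => q) (s := Icc c d) measurableSet_Icc
      (fun r _ => (((hasDerivAt_id r).const_mul q).const_add p |>.congr_deriv (by simp)
        ).hasDerivWithinAt)
      (fun r _ r' _ hr => by simpa [hq] using hr) (fun t => ψ t x)).1 ((h.integrable x).mono_set himg)
    have h2 := h1.const_mul (|q|⁻¹ * q)
    refine h2.congr (Eventually.of_forall fun r => ?_)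
    simp only [smul_eq_mul, Pi.smul_apply]
    have : |q| ≠ 0 := abs_ne_zero.2 hq
    field_simp
  · simp only [onsager_smul]
    rw [intervalIntegral.integral_const_mul, h.increment _ (hmap s hs) _ (hmap t ht),
      intervalIntegral.mul_integral_comp_add_mul (f := fun r => onsager Q (μ r) (ψ r) x)]

omit [DecidableEq X] in
-- The action is quadratic in `ψ`, which gives `q ^ 2`; the change of variables takes back one
-- factor `|q|`.
lemma energy_comp_affine {c d p q : ℝ} (μ ψ : ℝ → X → ℝ) (hq : q ≠ 0) :
    energy Q c d (fun r => μ (p + q * r)) (fun r => q • ψ (p + q * r)) =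
      ENNReal.ofReal |q| * ∫⁻ t in (fun r => p + q * r) '' Icc c d,
        ENNReal.ofReal (action Q (μ t) (ψ t)) := by
  rw [lintegral_image_eq_lintegral_abs_deriv_mul (f := fun r => p + q * r)
      (f' := fun _ => q) (s := Icc c d) measurableSet_Icc
      (fun r _ => (((hasDerivAt_id r).const_mul q).const_add p |>.congr_deriv (by simp)
        ).hasDerivWithinAt)
      (fun r _ r' _ hr => by simpa [hq] using hr), ← lintegral_const_mul' _ _ ENNReal.ofReal_ne_top,
      energy]
  refine lintegral_congr fun r => ?_
  rw [action_smul, ENNReal.ofReal_mul (sq_nonneg q), ← mul_assoc, ← ENNReal.ofReal_mul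
    (abs_nonneg q), ← sq, sq_abs]

omit [DecidableEq X] in
lemma energy_comp_affine_le {a b c d p q : ℝ} (μ ψ : ℝ → X → ℝ) (hq : q ≠ 0)
    (hmap : ∀ r ∈ Icc c d, p + q * r ∈ Icc a b) :
    energy Q c d (fun r => μ (p + q * r)) (fun r => q • ψ (p + q * r)) ≤
      ENNReal.ofReal |q| * energy Q a b μ ψ := by
  have himg : (fun r => p + q * r) '' Icc c d ⊆ Icc a b := image_subset_iff.2 hmap
  rw [energy_comp_affine μ ψ hq]
  exact mul_le_mul_right (lintegral_mono_set himg) _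

omit [DecidableEq X] in
lemma IsPath.mono {a b c d : ℝ} {μ ψ : ℝ → X → ℝ} (h : IsPath Q a b μ ψ)
    (hsub : Icc c d ⊆ Icc a b) : IsPath Q c d μ ψ :=
  ⟨h.continuousOn.mono hsub, fun t ht => h.mem_simplex t (hsub ht),
    fun x => (h.integrable x).mono_set hsub,
    fun s hs t ht x => h.increment s (hsub hs) t (hsub ht) x⟩

lemma IsNonlinearMarkovTriple.isPath_concat (hQ : IsNonlinearMarkovTriple K Q) {a b c : ℝ}
    (hab : a ≤ b) (hbc : b ≤ c) {μ ψ μ' ψ' : ℝ → X → ℝ} (h : IsPath Q a b μ ψ)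
    (h' : IsPath Q b c μ' ψ') (hb : μ b = μ' b) :
    IsPath Q a c (fun t => if t ≤ b then μ t else μ' t) (fun t => if t ≤ b then ψ t else ψ' t) := by
  have hIcc : Icc a c = Icc a b ∪ Icc b c := (Icc_union_Icc_eq_Icc hab hbc).symm
  have hIoc : Icc a c = Icc a b ∪ Ioc b c := (Icc_union_Ioc_eq_Icc hab hbc).symm
  have e2 : ∀ t ∈ Icc b c, (if t ≤ b then μ t else μ' t) = μ' t := by
    intro t ht
    split_ifs with htb
    · rw [le_antisymm htb ht.1, hb]
    · rfl
  have hcont : ContinuousOn (fun t => if t ≤ b then μ t else μ' t) (Icc a c) := by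
    rw [hIcc]
    exact (h.continuousOn.congr fun t ht => if_pos ht.2).union_of_isClosed
      (h'.continuousOn.congr e2) isClosed_Icc isClosed_Icc
  have hsimp : ∀ t ∈ Icc a c, (if t ≤ b then μ t else μ' t) ∈ stdSimplex ℝ X := by
    intro t ht
    split_ifs with htb
    · exact h.mem_simplex t ⟨ht.1, htb⟩
    · exact h'.mem_simplex t ⟨(not_le.1 htb).le, ht.2⟩
  have hint : ∀ x, IntegrableOn (fun t => (if t ≤ b then ψ t else ψ' t) x) (Icc a c) := by
    intro x
    rw [hIoc]
    refine IntegrableOn.union ?_ ?_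
    · exact (h.integrable x).congr_fun (fun t ht => by simp only [if_pos ht.2]) measurableSet_Icc
    · exact ((h'.integrable x).mono_set Ioc_subset_Icc_self).congr_fun
        (fun t ht => by simp only [if_neg (not_le.2 ht.1)]) measurableSet_Ioc
  refine hQ.isPath_of_increment hcont hsimp hint fun t ht x => ?_
  have hleft : ∀ t ∈ Icc a b, ∫ r in a..t, onsager Q (if r ≤ b then μ r else μ' r)
      (if r ≤ b then ψ r else ψ' r) x = μ t x - μ a x := by
    intro t ht
    rw [h.increment a ⟨le_rfl, hab⟩ t ht]
    refine intervalIntegral.integral_congr fun r hr => ?_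
    rw [uIcc_of_le ht.1] at hr
    simp only [if_pos (hr.2.trans ht.2)]
  simp only [if_pos hab]
  split_ifs with htb
  · rw [hleft t ⟨ht.1, htb⟩]
    ring
  · have hbt : b ≤ t := (not_le.1 htb).le
    have hii := hQ.integrableOn_onsager hcont hsimp hint x
    have hright : ∫ r in b..t, onsager Q (if r ≤ b then μ r else μ' r)
        (if r ≤ b then ψ r else ψ' r) x = μ' t x - μ' b x := by
      rw [h'.increment b ⟨le_rfl, hbc⟩ t ⟨hbt, ht.2⟩]
      refine intervalIntegral.integral_congr_ae (Eventually.of_forall fun r hr => ?_)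
      rw [uIoc_of_le hbt] at hr
      simp only [if_neg (not_le.2 hr.1)]
    rw [← intervalIntegral.integral_add_adjacent_intervals (b := b), hleft b ⟨hab, le_rfl⟩, hright,
      hb]
    · ring
    · exact (intervalIntegrable_iff_integrableOn_Icc_of_le hab).2
        (hii.mono_set (Icc_subset_Icc_right hbc))
    · exact (intervalIntegrable_iff_integrableOn_Icc_of_le hbt).2
        (hii.mono_set (Icc_subset_Icc hab ht.2))

omit [DecidableEq X] in
lemma energy_concat_le {a b c : ℝ} (hab : a ≤ b) (hbc : b ≤ c) (μ ψ μ' ψ' : ℝ → X → ℝ) :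
    energy Q a c (fun t => if t ≤ b then μ t else μ' t) (fun t => if t ≤ b then ψ t else ψ' t) ≤
      energy Q a b μ ψ + energy Q b c μ' ψ' := by
  rw [energy, ← Icc_union_Ioc_eq_Icc hab hbc]
  refine (lintegral_union_le _ _ _).trans (add_le_add (le_of_eq ?_) ?_)
  · refine setLIntegral_congr_fun measurableSet_Icc fun t ht => ?_
    simp only [if_pos ht.2]
  · refine le_trans (le_of_eq ?_) (lintegral_mono_set Ioc_subset_Icc_self)
    refine setLIntegral_congr_fun measurableSet_Ioc fun t ht => ?_
    simp only [if_neg (not_le.2 ht.1)]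

omit [DecidableEq X] in
lemma energy_add_energy {a b c : ℝ} (hab : a ≤ b) (hbc : b ≤ c) (μ ψ : ℝ → X → ℝ) :
    energy Q a b μ ψ + energy Q b c μ ψ = energy Q a c μ ψ := by
  have h : energy Q b c μ ψ = ∫⁻ t in Ioc b c, ENNReal.ofReal (action Q (μ t) (ψ t)) :=
    (setLIntegral_congr Ioc_ae_eq_Icc).symm
  rw [h, energy, energy, ← Icc_union_Ioc_eq_Icc hab hbc, lintegral_union measurableSet_Ioc]
  exact Set.disjoint_left.2 fun t ht ht' => not_lt.2 ht.2 ht'.1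

end Paths

/-! ### The transport distance: triangle inequality and Euclidean lower bound. -/

section Distance

variable {X : Type*} [Fintype X] [DecidableEq X] {K : (X → ℝ) → X → ℝ}
  {Q : (X → ℝ) → X → X → ℝ}

lemma sqrt_le_ofReal {E : ℝ≥0∞} {r : ℝ} (hr : 0 ≤ r) (h : E ≤ ENNReal.ofReal (r ^ 2)) :
    E ^ (1 / 2 : ℝ) ≤ ENNReal.ofReal r := by
  calc E ^ (1 / 2 : ℝ) ≤ ENNReal.ofReal (r ^ 2) ^ (1 / 2 : ℝ) :=
        ENNReal.rpow_le_rpow h (by norm_num)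
    _ = ENNReal.ofReal r := by
        rw [ENNReal.ofReal_rpow_of_nonneg (sq_nonneg r) (by norm_num), ← Real.sqrt_eq_rpow,
          Real.sqrt_sq hr]

namespace IsNonlinearMarkovTriple

variable (hQ : IsNonlinearMarkovTriple K Q)
include hQ

lemma transportDist_le {a b : ℝ} (hab : a < b) {μ ψ : ℝ → X → ℝ} (h : IsPath Q a b μ ψ) {r : ℝ}
    (hr : 0 ≤ r) (hE : ENNReal.ofReal (b - a) * energy Q a b μ ψ ≤ ENNReal.ofReal (r ^ 2)) :
    transportDist Q (μ a) (μ b) ≤ ENNReal.ofReal r := by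
  have hq : b - a ≠ 0 := (sub_pos.2 hab).ne'
  have hmap : ∀ r ∈ Icc (0 : ℝ) 1, a + (b - a) * r ∈ Icc a b := fun r hr => by
    constructor <;> nlinarith [hr.1, hr.2]
  have hp := h.comp_affine hq hmap
  have hen := energy_comp_affine_le (Q := Q) μ ψ hq hmap
  rw [abs_of_pos (sub_pos.2 hab)] at hen
  refine le_trans (iInf_le_of_le (fun r => μ (a + (b - a) * r)) (iInf_le_of_le
    (fun r => (b - a) • ψ (a + (b - a) * r)) (iInf_le_of_le ?_ le_rfl)))
    (sqrt_le_ofReal hr (hen.trans hE))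
  refine hQ.isCESolution_iff.2 ⟨hp, ?_, ?_⟩
  · simp
  · simp

lemma exists_path_of_transportDist_lt {μ₀ μ₁ : X → ℝ} {r : ℝ}
    (h : transportDist Q μ₀ μ₁ < ENNReal.ofReal r) :
    ∃ μ ψ, IsPath Q 0 1 μ ψ ∧ μ 0 = μ₀ ∧ μ 1 = μ₁ ∧ energy Q 0 1 μ ψ ≤ ENNReal.ofReal (r ^ 2) := by
  simp only [transportDist, iInf_lt_iff] at h
  obtain ⟨μ, ψ, hce, hlt⟩ := h
  obtain ⟨hp, h0, h1⟩ := hQ.isCESolution_iff.1 hce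
  refine ⟨μ, ψ, hp, h0, h1, ?_⟩
  have hr : 0 ≤ r := le_of_lt (ENNReal.ofReal_pos.1 (bot_le.trans_lt hlt))
  have h2 := ENNReal.rpow_le_rpow hlt.le (z := 2) (by norm_num)
  rw [← ENNReal.rpow_mul] at h2
  norm_num at h2
  rwa [energy, ENNReal.ofReal_pow hr]

lemma transportDist_comm (μ₀ μ₁ : X → ℝ) : transportDist Q μ₀ μ₁ = transportDist Q μ₁ μ₀ := by
  have h : ∀ μ₀ μ₁, transportDist Q μ₀ μ₁ ≤ transportDist Q μ₁ μ₀ := by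
    intro μ₀ μ₁
    refine le_iInf fun μ => le_iInf fun ψ => le_iInf fun hce => ?_
    obtain ⟨hp, h0, h1⟩ := hQ.isCESolution_iff.1 hce
    have hmap : ∀ r ∈ Icc (0 : ℝ) 1, 1 + (-1) * r ∈ Icc (0 : ℝ) 1 := fun r hr => by
      constructor <;> linarith [hr.1, hr.2]
    have hen := energy_comp_affine_le (Q := Q) μ ψ (by norm_num) hmap
    simp only [abs_neg, abs_one, ENNReal.ofReal_one, one_mul] at hen
    refine iInf_le_of_le _ (iInf_le_of_le _ (iInf_le_of_le (hQ.isCESolution_iff.2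
      ⟨hp.comp_affine (by norm_num) hmap, ?_, ?_⟩) (ENNReal.rpow_le_rpow hen (by norm_num))))
    · simp [h1]
    · simp [h0]
  exact le_antisymm (h _ _) (h _ _)

/-- Almost optimal curves of lengths about `r` and `r'` are run in times `r` and `r'`, so each piece
has energy at most its own duration. The concatenation has energy at most `r + r'` over a time `r +
r'`, hence length at most `r + r'`. -/
lemma transportDist_triangle (μ₀ μ₁ μ₂ : X → ℝ) :
    transportDist Q μ₀ μ₂ ≤ transportDist Q μ₀ μ₁ + transportDist Q μ₁ μ₂ := by
  rcases eq_or_ne (transportDist Q μ₀ μ₁) ⊤ with ht | ht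
  · simp [ht]
  rcases eq_or_ne (transportDist Q μ₁ μ₂) ⊤ with ht' | ht'
  · simp [ht']
  refine ENNReal.le_of_forall_pos_le_add fun ε hε _ => ?_
  have hε' : (0 : ℝ) < ε := hε
  set r := (transportDist Q μ₀ μ₁).toReal + ε / 2 with hr
  set r' := (transportDist Q μ₁ μ₂).toReal + ε / 2 with hr'
  have hr0 : 0 < r := by positivity
  have hr0' : 0 < r' := by positivity
  have hlt : ∀ {w : ℝ≥0∞}, w ≠ ⊤ → w < ENNReal.ofReal (w.toReal + ε / 2) := fun {w} hw => by
    rw [ENNReal.lt_ofReal_iff_toReal_lt hw]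
    linarith
  obtain ⟨μ, ψ, hp, h0, h1, hE⟩ := hQ.exists_path_of_transportDist_lt (hlt ht)
  obtain ⟨μ', ψ', hp', h0', h1', hE'⟩ := hQ.exists_path_of_transportDist_lt (hlt ht')
  rw [← hr] at hE
  rw [← hr'] at hE'
  have hq : r⁻¹ ≠ 0 := (inv_pos.2 hr0).ne'
  have hq' : r'⁻¹ ≠ 0 := (inv_pos.2 hr0').ne'
  have hmap : ∀ s ∈ Icc 0 r, 0 + r⁻¹ * s ∈ Icc (0 : ℝ) 1 := fun s hs => by
    rw [zero_add, ← div_eq_inv_mul]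
    exact ⟨div_nonneg hs.1 hr0.le, (div_le_one hr0).2 hs.2⟩
  have hmap' : ∀ s ∈ Icc r (r + r'), -(r'⁻¹ * r) + r'⁻¹ * s ∈ Icc (0 : ℝ) 1 := fun s hs => by
    have : -(r'⁻¹ * r) + r'⁻¹ * s = (s - r) / r' := by field_simp; ring
    rw [this]
    exact ⟨div_nonneg (by linarith [hs.1]) hr0'.le, (div_le_one hr0').2 (by linarith [hs.2])⟩
  have hen : ∀ {s : ℝ} {E : ℝ≥0∞}, 0 < s → E ≤ ENNReal.ofReal (s ^ 2) →
      ENNReal.ofReal |s⁻¹| * E ≤ ENNReal.ofReal s := by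
    intro s E hs hE
    refine (mul_le_mul_right hE _).trans (le_of_eq ?_)
    rw [← ENNReal.ofReal_mul (abs_nonneg _), abs_of_pos (inv_pos.2 hs)]
    congr 1
    field_simp
  have hcat := hQ.isPath_concat hr0.le (le_add_of_nonneg_right hr0'.le)
    (hp.comp_affine hq hmap) (hp'.comp_affine hq' hmap') (by
      rw [zero_add, inv_mul_cancel₀ hr0.ne', neg_add_cancel, h1, h0'])
  have hEcat := energy_concat_le (Q := Q) hr0.le (le_add_of_nonneg_right hr0'.le)
    (fun s => μ (0 + r⁻¹ * s)) (fun s => r⁻¹ • ψ (0 + r⁻¹ * s))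
    (fun s => μ' (-(r'⁻¹ * r) + r'⁻¹ * s)) (fun s => r'⁻¹ • ψ' (-(r'⁻¹ * r) + r'⁻¹ * s))
  have hEcat2 := hEcat.trans (add_le_add
    ((energy_comp_affine_le μ ψ hq hmap).trans (hen hr0 hE))
    ((energy_comp_affine_le μ' ψ' hq' hmap').trans (hen hr0' hE')))
  have hfin := hQ.transportDist_le (by linarith : (0 : ℝ) < r + r') hcat (r := r + r')
    (by positivity) (by
      rw [sub_zero]
      refine (mul_le_mul_right hEcat2 _).trans (le_of_eq ?_)
      rw [← ENNReal.ofReal_add hr0.le hr0'.le, ← ENNReal.ofReal_mul (by positivity), sq])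
  have hend : -(r'⁻¹ * r) + r'⁻¹ * (r + r') = 1 := by field_simp; ring
  simp only [hr0.le, if_true, mul_zero, add_zero, h0, not_le.2 (lt_add_of_pos_right r hr0'),
    if_false, hend, h1'] at hfin
  refine hfin.trans (le_of_eq ?_)
  have : r + r' = (transportDist Q μ₀ μ₁).toReal + (transportDist Q μ₁ μ₂).toReal + ε := by
    rw [hr, hr']; ring
  rw [this, ENNReal.ofReal_add (by positivity) hε'.le, ENNReal.ofReal_add (by positivity)
    (by positivity), ENNReal.ofReal_toReal ht, ENNReal.ofReal_toReal ht', ENNReal.ofReal_coe_nnreal]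

/-- Along a path of energy at most `e²`, the pairing with a function `D` whose action is bounded by
`M²` changes by at most `M e`. -/
lemma abs_sum_mul_increment_le {μ ψ : ℝ → X → ℝ} (h : IsPath Q 0 1 μ ψ) {e M : ℝ} (he : 0 < e)
    (hM : 0 < M) (hE : energy Q 0 1 μ ψ ≤ ENNReal.ofReal (e ^ 2)) {D : X → ℝ} {t : ℝ}
    (ht : t ∈ Icc (0 : ℝ) 1) (hD : ∀ s ∈ Icc 0 t, action Q (μ s) D ≤ M ^ 2) :
    |∑ x, D x * (μ t x - μ 0 x)| ≤ M * e := by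
  have h0 : (0 : ℝ) ∈ Icc (0 : ℝ) 1 := ⟨le_rfl, zero_le_one⟩
  have hint := hQ.integrableOn_onsager h.continuousOn h.mem_simplex h.integrable
  have hsub : Icc 0 t ⊆ Icc (0 : ℝ) 1 := Icc_subset_Icc_right ht.2
  have h1 : ∑ x, D x * (μ t x - μ 0 x) =
      ∫ r in (0 : ℝ)..t, ∑ x, D x * onsager Q (μ r) (ψ r) x := by
    rw [intervalIntegral.integral_finsetSum]
    · refine Finset.sum_congr rfl fun x _ => ?_
      rw [intervalIntegral.integral_const_mul, h.increment 0 h0 t ht]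
    · intro x _
      exact ((intervalIntegrable_iff_integrableOn_Icc_of_le ht.1).2
        ((hint x).mono_set hsub)).const_mul _
  have hMe : 0 < M * e := mul_pos hM he
  have h2 : ‖∫ r in (0 : ℝ)..t, ∑ x, D x * onsager Q (μ r) (ψ r) x‖ₑ ≤ ENNReal.ofReal (M * e) := by
    rw [intervalIntegral.integral_of_le ht.1]
    refine (enorm_integral_le_lintegral_enorm _).trans ?_
    -- Young's inequality with `l = e / M`, the value for which the two terms contribute `M * e / 2`
    -- each after integration.
    have hpt : ∀ r ∈ Icc 0 t, ‖∑ x, D x * onsager Q (μ r) (ψ r) x‖ₑ ≤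
        ENNReal.ofReal (M * e / 2) +
          ENNReal.ofReal (M / (2 * e)) * ENNReal.ofReal (action Q (μ r) (ψ r)) := by
      intro r hr
      rw [← ENNReal.ofReal_mul (by positivity), ← ENNReal.ofReal_add (by positivity)
        (mul_nonneg (by positivity) (hQ.action_nonneg (h.mem_simplex r (hsub hr)) _)),
        Real.enorm_eq_ofReal_abs]
      refine ENNReal.ofReal_le_ofReal ?_
      refine (hQ.abs_sum_mul_onsager_le (h.mem_simplex r (hsub hr)) (ψ r) D
        (div_pos he hM)).trans ?_
      have h3 : e / M * action Q (μ r) D ≤ e / M * M ^ 2 :=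
        mul_le_mul_of_nonneg_left (hD r hr) (by positivity)
      have h4 : e / M * M ^ 2 = M * e := by field_simp
      have h5 : (1 / 2) * ((e / M)⁻¹ * action Q (μ r) (ψ r)) =
          M / (2 * e) * action Q (μ r) (ψ r) := by field_simp
      linarith
    calc ∫⁻ r in Ioc 0 t, ‖∑ x, D x * onsager Q (μ r) (ψ r) x‖ₑ
        ≤ ∫⁻ r in Ioc 0 t, (ENNReal.ofReal (M * e / 2) +
          ENNReal.ofReal (M / (2 * e)) * ENNReal.ofReal (action Q (μ r) (ψ r))) :=
          setLIntegral_mono' measurableSet_Ioc fun r hr => hpt r (Ioc_subset_Icc_self hr)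
      _ ≤ ∫⁻ r in Icc 0 1, (ENNReal.ofReal (M * e / 2) +
          ENNReal.ofReal (M / (2 * e)) * ENNReal.ofReal (action Q (μ r) (ψ r))) :=
          lintegral_mono_set (Ioc_subset_Icc_self.trans hsub)
      _ = ENNReal.ofReal (M * e / 2) + ENNReal.ofReal (M / (2 * e)) * energy Q 0 1 μ ψ := by
          rw [lintegral_add_left measurable_const, lintegral_const_mul' _ _ ENNReal.ofReal_ne_top,
            energy]
          simp
      _ ≤ ENNReal.ofReal (M * e / 2) +
          ENNReal.ofReal (M / (2 * e)) * ENNReal.ofReal (e ^ 2) := by gcongr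
      _ = ENNReal.ofReal (M * e) := by
          rw [← ENNReal.ofReal_mul (by positivity), ← ENNReal.ofReal_add (by positivity)
            (by positivity)]
          congr 1
          field_simp
          norm_num
  rw [h1]
  rwa [Real.enorm_eq_ofReal_abs, ENNReal.ofReal_le_ofReal_iff hMe.le] at h2

/-- The Euclidean displacement is controlled by the energy. -/
lemma exists_dist_le : ∃ C : ℝ, 0 < C ∧ ∀ (μ ψ : ℝ → X → ℝ) (e : ℝ), IsPath Q 0 1 μ ψ → 0 < e →
    energy Q 0 1 μ ψ ≤ ENNReal.ofReal (e ^ 2) → ∀ t ∈ Icc (0 : ℝ) 1, dist (μ t) (μ 0) ≤ C * e := by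
  obtain ⟨C, hC, hCb⟩ := hQ.exists_edgeWeight_le
  -- The test functions are the coordinate indicators, of action at most `|X|² C / 2`; `M` is chosen
  -- so that `M ^ 2` exceeds this.
  set M : ℝ := Fintype.card X * C + 1 + Fintype.card X with hMdef
  have hM : 0 < M := by positivity
  refine ⟨M, hM, fun μ ψ e h he hE t ht => ?_⟩
  rw [dist_pi_le_iff (by positivity)]
  intro x
  have hb := hQ.abs_sum_mul_increment_le h he hM hE (D := Pi.single x 1) ht fun s hs => ?_
  · simpa [Pi.single_apply, Real.dist_eq] using hb
  · have hs' := h.mem_simplex s ⟨hs.1, hs.2.trans ht.2⟩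
    have hterm : ∀ a b : X, ((Pi.single x 1 : X → ℝ) b - (Pi.single x 1 : X → ℝ) a) ^ 2 *
        edgeWeight Q (μ s) a b ≤ C := by
      intro a b
      by_cases hab : a = b
      · simp [hab, hC.le]
      · have h1 : ((Pi.single x 1 : X → ℝ) b - (Pi.single x 1 : X → ℝ) a) ^ 2 ≤ 1 := by
          simp only [Pi.single_apply]
          split_ifs <;> norm_num
        calc _ ≤ 1 * edgeWeight Q (μ s) a b :=
              mul_le_mul_of_nonneg_right h1 (hQ.edgeWeight_nonneg hs' hab)
          _ ≤ C := by rw [one_mul]; exact hCb _ hs' a b hab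
    have hsum : action Q (μ s) (Pi.single x 1) ≤ (1 / 2) * ∑ _a : X, ∑ _b : X, C :=
      mul_le_mul_of_nonneg_left
        (Finset.sum_le_sum fun a _ => Finset.sum_le_sum fun b _ => hterm a b) (by norm_num)
    simp only [Finset.sum_const, Finset.card_univ, nsmul_eq_mul] at hsum
    have hn : (0 : ℝ) ≤ Fintype.card X := by positivity
    have : 0 ≤ (Fintype.card X : ℝ) * C := by positivity
    nlinarith

end IsNonlinearMarkovTriple

end Distance

/-! ### A discrete heat flow on a weighted graph. -/

section Diffusion

variable {X : Type*} [Fintype X]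

/-- The graph Laplacian with edge weights `w`. -/
def graphLaplacian (w : X → X → ℝ) (ν : X → ℝ) (x : X) : ℝ :=
  ∑ y, w x y * (ν y - ν x)

lemma graphLaplacian_const_mul (w : X → X → ℝ) (c : ℝ) (f : X → ℝ) (x : X) :
    graphLaplacian w (fun y => c * f y) x = c * graphLaplacian w f x := by
  rw [graphLaplacian, graphLaplacian, Finset.mul_sum]
  exact Finset.sum_congr rfl fun y _ => by ring

/-- The explicit Euler step of size `t` of the heat flow of a weighted graph. -/
def diffusionStep (w : X → X → ℝ) (t : ℝ) (ν : X → ℝ) (x : X) : ℝ :=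
  ν x + t * graphLaplacian w ν x

lemma continuous_iterate_diffusionStep (w : X → X → ℝ) (k : ℕ) :
    Continuous fun p : ℝ × (X → ℝ) => (diffusionStep w p.1)^[k] p.2 := by
  induction k with
  | zero => exact continuous_snd
  | succ k ih =>
    simp only [Function.iterate_succ_apply']
    refine continuous_pi fun x => ?_
    simp only [diffusionStep, graphLaplacian]
    fun_prop

lemma iterate_diffusionStep_zero (w : X → X → ℝ) (k : ℕ) (ν : X → ℝ) :
    (diffusionStep w 0)^[k] ν = ν := by
  have : diffusionStep w 0 = id := by
    funext ν x
    simp [diffusionStep]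
  simp [this]

/-- With `Δ` the graph Laplacian, the iterate is `(1 + tΔ)^(k+1) μ`, and `Δ` is linear and commutes
with `1 + tΔ`. The velocity is therefore driven by the iterate with one step fewer. -/
lemma hasDerivAt_iterate_diffusionStep (w : X → X → ℝ) (μ : X → ℝ) (k : ℕ) (t : ℝ) (x : X) :
    HasDerivAt (fun t => (diffusionStep w t)^[k + 1] μ x)
      ((k + 1) * graphLaplacian w ((diffusionStep w t)^[k] μ) x) t := by
  induction k generalizing x with
  | zero =>
    simp only [zero_add, Function.iterate_one, Function.iterate_zero, id, diffusionStep]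
    exact (((hasDerivAt_id t).mul_const _).const_add (μ x)).congr_deriv (by simp)
  | succ k ih =>
    simp only [Function.iterate_succ_apply' _ (k + 1)]
    have h1 : HasDerivAt (fun t => graphLaplacian w ((diffusionStep w t)^[k + 1] μ) x)
        (graphLaplacian w (fun y => (k + 1) * graphLaplacian w ((diffusionStep w t)^[k] μ) y) x)
        t := by
      simp only [graphLaplacian]
      exact HasDerivAt.fun_sum fun y _ => ((ih y).sub (ih x)).const_mul _
    have h2 := (ih x).fun_add ((hasDerivAt_id t).fun_mul h1)
    refine h2.congr_deriv ?_
    have h3 : graphLaplacian w ((diffusionStep w t)^[k + 1] μ) x =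
        graphLaplacian w ((diffusionStep w t)^[k] μ) x +
          t * graphLaplacian w (graphLaplacian w ((diffusionStep w t)^[k] μ)) x := by
      rw [Function.iterate_succ_apply']
      generalize (diffusionStep w t)^[k] μ = ν
      rw [graphLaplacian, graphLaplacian, graphLaplacian, Finset.mul_sum, ← Finset.sum_add_distrib]
      refine Finset.sum_congr rfl fun y _ => ?_
      simp only [diffusionStep]
      ring
    have h4 : graphLaplacian w (fun y => (k + 1) * graphLaplacian w ((diffusionStep w t)^[k] μ) y) x
        = (k + 1) * graphLaplacian w (graphLaplacian w ((diffusionStep w t)^[k] μ)) x :=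
      graphLaplacian_const_mul w _ _ x
    rw [h4]
    simp only [id, one_mul]
    push_cast
    linear_combination (-((k : ℝ) + 1)) * h3

/-- Each point sends out at most the fraction `1 - δ` of its mass and so keeps at least `δ` of it.
-/
lemma le_diffusionStep {w : X → X → ℝ} {δ : ℝ} (hw : ∀ x, ∑ y, w x y ≤ 1 - δ)
    (hw0 : ∀ x y, 0 ≤ w x y) {t : ℝ} (ht : t ∈ Icc (0 : ℝ) 1) {ν : X → ℝ} (hν : ∀ x, 0 ≤ ν x)
    (x : X) :
    δ * ν x + t * ∑ y, w x y * ν y ≤ diffusionStep w t ν x := by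
  have h : diffusionStep w t ν x =
      (1 - t * ∑ y, w x y) * ν x + t * ∑ y, w x y * ν y := by
    simp only [diffusionStep, graphLaplacian, mul_sub, Finset.sum_sub_distrib, ← Finset.sum_mul]
    ring
  rw [h]
  have h1 : t * ∑ y, w x y ≤ 1 - δ := by
    calc t * ∑ y, w x y ≤ 1 * ∑ y, w x y :=
          mul_le_mul_of_nonneg_right ht.2 (Finset.sum_nonneg fun y _ => hw0 x y)
      _ ≤ 1 - δ := by rw [one_mul]; exact hw x
  have := mul_le_mul_of_nonneg_right (by linarith : δ ≤ 1 - t * ∑ y, w x y) (hν x)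
  linarith

variable [DecidableEq X]

lemma sum_diffusionStep {w : X → X → ℝ} (hsymm : ∀ x y, w x y = w y x) (t : ℝ) (ν : X → ℝ) :
    ∑ x, diffusionStep w t ν x = ∑ x, ν x := by
  simp only [diffusionStep, graphLaplacian, Finset.sum_add_distrib, ← Finset.mul_sum,
    sum_laplace_eq_zero hsymm, mul_zero, add_zero]

lemma diffusionStep_mem_stdSimplex {w : X → X → ℝ} (hsymm : ∀ x y, w x y = w y x) {δ : ℝ}
    (hδ0 : 0 ≤ δ) (hw : ∀ x, ∑ y, w x y ≤ 1 - δ) (hw0 : ∀ x y, 0 ≤ w x y) {t : ℝ}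
    (ht : t ∈ Icc (0 : ℝ) 1) {ν : X → ℝ} (hν : ν ∈ stdSimplex ℝ X) :
    diffusionStep w t ν ∈ stdSimplex ℝ X := by
  refine ⟨fun x => le_trans ?_ (le_diffusionStep hw hw0 ht hν.1 x), ?_⟩
  · have h1 : 0 ≤ ∑ y, w x y * ν y :=
      Finset.sum_nonneg fun y _ => mul_nonneg (hw0 x y) (hν.1 y)
    have := mul_nonneg hδ0 (hν.1 x)
    have := mul_nonneg ht.1 h1
    linarith
  · rw [sum_diffusionStep hsymm, hν.2]

lemma iterate_diffusionStep_mem_stdSimplex {w : X → X → ℝ} (hsymm : ∀ x y, w x y = w y x) {δ : ℝ}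
    (hδ0 : 0 ≤ δ) (hw : ∀ x, ∑ y, w x y ≤ 1 - δ) (hw0 : ∀ x y, 0 ≤ w x y) {t : ℝ}
    (ht : t ∈ Icc (0 : ℝ) 1) {ν : X → ℝ} (hν : ν ∈ stdSimplex ℝ X) (k : ℕ) :
    (diffusionStep w t)^[k] ν ∈ stdSimplex ℝ X := by
  induction k with
  | zero => exact hν
  | succ k ih =>
    rw [Function.iterate_succ_apply']
    exact diffusionStep_mem_stdSimplex hsymm hδ0 hw hw0 ht ih

/-- After `|X|` steps a diffusion on a connected graph has reached every point. -/
lemma le_iterate_diffusionStep {w : X → X → ℝ} (hsymm : ∀ x y, w x y = w y x) {δ : ℝ}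
    (hδ0 : 0 < δ) (hw : ∀ x, ∑ y, w x y ≤ 1 - δ)
    (hw0 : ∀ x y, w x y = 0 ∨ δ ≤ w x y) (hconn : IsConnecting w) {t : ℝ}
    (ht : t ∈ Icc (0 : ℝ) 1) {ν : X → ℝ} (hν : ν ∈ stdSimplex ℝ X) {x₀ : X} {m : ℝ} (hm : 0 ≤ m)
    (hx₀ : m ≤ ν x₀) (x : X) :
    (δ * t) ^ Fintype.card X * m ≤ (diffusionStep w t)^[Fintype.card X] ν x := by
  have hwn : ∀ x y, 0 ≤ w x y := fun x y => by
    rcases hw0 x y with h | h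
    · exact h.ge
    · exact hδ0.le.trans h
  -- The points already carrying mass `(δ * t) ^ k * m`. A step retains at least the share `δ ≥ δ *
  -- t` at a point and passes at least `δ * t` to each neighbour, so `R k` grows across some edge
  -- until it is all of `X`.
  let R : ℕ → Finset X := fun k =>
    Finset.univ.filter fun z => (δ * t) ^ k * m ≤ (diffusionStep w t)^[k] ν z
  have hmem : ∀ k z, z ∈ R k ↔ (δ * t) ^ k * m ≤ (diffusionStep w t)^[k] ν z :=
    fun k z => by simp [R]
  have hδt : 0 ≤ δ * t := mul_nonneg hδ0.le ht.1
  have hstep : ∀ k z, δ * (diffusionStep w t)^[k] ν z +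
      t * ∑ y, w z y * (diffusionStep w t)^[k] ν y ≤ (diffusionStep w t)^[k + 1] ν z := by
    intro k z
    rw [Function.iterate_succ_apply']
    exact le_diffusionStep hw hwn ht
      (iterate_diffusionStep_mem_stdSimplex hsymm hδ0.le hw hwn ht hν k).1 z
  have hnn : ∀ k z, 0 ≤ (diffusionStep w t)^[k] ν z := fun k z =>
    (iterate_diffusionStep_mem_stdSimplex hsymm hδ0.le hw hwn ht hν k).1 z
  have hmono : ∀ k, R k ⊆ R (k + 1) := by
    intro k z hz
    rw [hmem] at hz ⊢
    refine le_trans ?_ (hstep k z)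
    have h1 : 0 ≤ t * ∑ y, w z y * (diffusionStep w t)^[k] ν y :=
      mul_nonneg ht.1 (Finset.sum_nonneg fun y _ => mul_nonneg (hwn z y) (hnn k y))
    have h2 : (δ * t) ^ (k + 1) * m ≤ δ * ((δ * t) ^ k * m) := by
      have h3 : 0 ≤ δ * ((δ * t) ^ k * m) := by positivity
      calc (δ * t) ^ (k + 1) * m = t * (δ * ((δ * t) ^ k * m)) := by ring
        _ ≤ 1 * (δ * ((δ * t) ^ k * m)) := mul_le_mul_of_nonneg_right ht.2 h3
        _ = _ := one_mul _
    have := mul_le_mul_of_nonneg_left hz hδ0.le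
    linarith
  have hnbr : ∀ k a b, a ∈ R k → 0 < w a b → b ∈ R (k + 1) := by
    intro k a b ha hab
    rw [hmem] at ha ⊢
    refine le_trans ?_ (hstep k b)
    have h1 : δ * (diffusionStep w t)^[k] ν a ≤ ∑ y, w b y * (diffusionStep w t)^[k] ν y := by
      refine le_trans ?_ (Finset.single_le_sum
        (f := fun y => w b y * (diffusionStep w t)^[k] ν y)
        (fun y _ => mul_nonneg (hwn b y) (hnn k y)) (Finset.mem_univ a))
      refine mul_le_mul_of_nonneg_right ?_ (hnn k a)
      rw [hsymm b a]
      exact (hw0 a b).resolve_left hab.ne'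
    have h2 := mul_le_mul_of_nonneg_left h1 ht.1
    have h3 := mul_le_mul_of_nonneg_left ha hδt
    have h4 : 0 ≤ δ * (diffusionStep w t)^[k] ν b := mul_nonneg hδ0.le (hnn k b)
    calc (δ * t) ^ (k + 1) * m = δ * t * ((δ * t) ^ k * m) := by ring
      _ ≤ _ := by linarith
  have hgrow : ∀ k, R k = Finset.univ ∨ k + 1 ≤ (R k).card := by
    intro k
    induction k with
    | zero => exact Or.inr (Finset.card_pos.2 ⟨x₀, by rw [hmem]; simpa using hx₀⟩)
    | succ k ih =>
      by_cases hu : R k = Finset.univ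
      · exact Or.inl (Finset.univ_subset_iff.1 (hu ▸ hmono k))
      have hc := ih.resolve_left hu
      obtain ⟨a, ha, b, hb, hab⟩ := hconn (R k) (Finset.card_pos.1 (by omega)) hu
      have hlt : R k ⊂ R (k + 1) := (hmono k).ssubset_of_ne fun heq =>
        Finset.mem_compl.1 hb (heq ▸ hnbr k a b ha hab)
      have := Finset.card_lt_card hlt
      exact Or.inr (by omega)
  have huniv : R (Fintype.card X) = Finset.univ := by
    rcases hgrow (Fintype.card X) with h | h
    · exact h
    · have := Finset.card_le_univ (R (Fintype.card X))
      omega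
  exact (hmem _ _).1 (huniv ▸ Finset.mem_univ x)

end Diffusion

/-! ### From smooth curves to solutions of the continuity equation. -/

section CurveToPath

variable {X : Type*} [Fintype X] [DecidableEq X] {K : (X → ℝ) → X → ℝ}
  {Q : (X → ℝ) → X → X → ℝ}

namespace IsNonlinearMarkovTriple

variable (hQ : IsNonlinearMarkovTriple K Q)
include hQ

lemma action_le_of_abs_sub_le {μ : X → ℝ} (hμ : μ ∈ stdSimplex ℝ X) {ψ : X → ℝ} {C g : ℝ}
    (hC : 0 ≤ C) (hCb : ∀ x y, x ≠ y → edgeWeight Q μ x y ≤ C) (hψ : ∀ x y, |ψ y - ψ x| ≤ g) :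
    action Q μ ψ ≤ (Fintype.card X : ℝ) ^ 2 * C * g ^ 2 := by
  have hterm : ∀ x y, (ψ y - ψ x) ^ 2 * edgeWeight Q μ x y ≤ g ^ 2 * C := by
    intro x y
    by_cases hxy : x = y
    · have : 0 ≤ g ^ 2 * C := by positivity
      simpa [hxy] using this
    · refine mul_le_mul ?_ (hCb x y hxy) (hQ.edgeWeight_nonneg hμ hxy) (sq_nonneg g)
      rw [← sq_abs]
      exact pow_le_pow_left₀ (abs_nonneg _) (hψ x y) 2
  have h1 : ∑ x, ∑ y, (ψ y - ψ x) ^ 2 * edgeWeight Q μ x y ≤ ∑ _x : X, ∑ _y : X, g ^ 2 * C :=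
    Finset.sum_le_sum fun x _ => Finset.sum_le_sum fun y _ => hterm x y
  have h2 : 0 ≤ ∑ x, ∑ y, (ψ y - ψ x) ^ 2 * edgeWeight Q μ x y := by
    have := hQ.action_nonneg hμ ψ
    rw [action] at this
    linarith
  simp only [Finset.sum_const, Finset.card_univ, nsmul_eq_mul] at h1
  rw [action]
  nlinarith

/-- A smooth curve whose flow through cuts is controlled by the edge weights solves the continuity
equation. -/
theorem exists_isPath_of_cut_le {C T : ℝ} (hC : 0 ≤ C)
    (hCb : ∀ μ ∈ stdSimplex ℝ X, ∀ x y, x ≠ y → edgeWeight Q μ x y ≤ C)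
    {μ v : ℝ → X → ℝ} {g : ℝ → ℝ} (hd : ∀ t x, HasDerivAt (fun t => μ t x) (v t x) t)
    (hv : ∀ x, Continuous fun t => v t x) (hv0 : ∀ t, ∑ x, v t x = 0)
    (hs : ∀ t ∈ Icc 0 T, μ t ∈ stdSimplex ℝ X)
    (hconn : ∀ t ∈ Ioo 0 T, IsConnecting (edgeWeight Q (μ t))) (hg : ∀ t ∈ Ioo 0 T, 0 ≤ g t)
    (hgi : IntegrableOn g (Ioo 0 T))
    (hcut : ∀ t ∈ Ioo 0 T, ∀ S : Finset X,
      |∑ x ∈ S, v t x| ≤ g t * ∑ x ∈ S, ∑ y ∈ Sᶜ, edgeWeight Q (μ t) x y) :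
    ∃ ψ, IsPath Q 0 T μ ψ ∧ energy Q 0 T μ ψ ≤
      ∫⁻ t in Ioo 0 T, ENNReal.ofReal ((Fintype.card X : ℝ) ^ 4 * C * g t ^ 2) := by
  have hμc : Continuous μ :=
    continuous_pi fun x => continuous_iff_continuousAt.2 fun t => (hd t x).continuousAt
  have hsymm : ∀ t x y, edgeWeight Q (μ t) x y = edgeWeight Q (μ t) y x := fun t =>
    edgeWeight_comm Q (μ t)
  have hnn : ∀ t ∈ Ioo 0 T, ∀ x y, x ≠ y → 0 ≤ edgeWeight Q (μ t) x y := fun t ht x y hxy =>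
    hQ.edgeWeight_nonneg (hs t (Ioo_subset_Icc_self ht)) hxy
  -- Only the open interval is controlled: at the endpoints the weights may fail to connect `X` and
  -- `g` may blow up, but two points do not affect the integrals.
  let ψ : ℝ → X → ℝ := fun t => laplaceSolution (edgeWeight Q (μ t)) (v t)
  have hψc : ∀ x, ContinuousOn (fun t => ψ t x) (Ioo 0 T) := by
    refine continuousOn_laplaceSolution (fun x y hxy => ?_) (fun x => (hv x).continuousOn)
      fun t ht => isUnit_det_laplaceMatrix (hsymm t) (hnn t ht) (hconn t ht)
    exact (hQ.continuousOn_edgeWeight hxy).comp hμc.continuousOn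
      fun t ht => hs t (Ioo_subset_Icc_self ht)
  have hψi : ∀ x, IntegrableOn (fun t => ψ t x) (Icc 0 T) := by
    intro x
    rw [integrableOn_Icc_iff_integrableOn_Ioo]
    refine Integrable.mono' (hgi.const_mul (Fintype.card X : ℝ))
      ((hψc x).aestronglyMeasurable measurableSet_Ioo) ?_
    filter_upwards [ae_restrict_mem measurableSet_Ioo] with t ht
    exact abs_laplaceSolution_le (hsymm t) (hnn t ht) (hconn t ht) (hv0 t) (hg t ht) (hcut t ht) x
  have hons : ∀ t ∈ Ioo 0 T, ∀ x, onsager Q (μ t) (ψ t) x = v t x := fun t ht x =>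
    laplaceSolution_spec (hsymm t) (hnn t ht) (hconn t ht) (hv0 t) x
  refine ⟨ψ, hQ.isPath_of_increment hμc.continuousOn hs hψi fun t ht x => ?_, ?_⟩
  · have h1 := intervalIntegral.integral_eq_sub_of_hasDerivAt (a := 0) (b := t)
      (fun s _ => hd s x) ((hv x).intervalIntegrable _ _)
    have h2 : ∫ r in (0 : ℝ)..t, onsager Q (μ r) (ψ r) x = ∫ r in (0 : ℝ)..t, v r x := by
      rw [intervalIntegral.integral_of_le ht.1, intervalIntegral.integral_of_le ht.1,
        integral_Ioc_eq_integral_Ioo, integral_Ioc_eq_integral_Ioo]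
      exact setIntegral_congr_fun measurableSet_Ioo fun r hr =>
        hons r ⟨hr.1, hr.2.trans_le ht.2⟩ x
    rw [h2, h1]
    ring
  · rw [energy, ← setLIntegral_congr Ioo_ae_eq_Icc]
    refine setLIntegral_mono' measurableSet_Ioo fun t ht => ENNReal.ofReal_le_ofReal ?_
    have h1 := hQ.action_le_of_abs_sub_le (hs t (Ioo_subset_Icc_self ht)) hC
      (hCb _ (hs t (Ioo_subset_Icc_self ht))) (ψ := ψ t) fun x y =>
        abs_laplaceSolution_sub_le (hsymm t) (hnn t ht) (hconn t ht) (hv0 t) (hg t ht) (hcut t ht)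
          x y
    refine h1.trans (le_of_eq ?_)
    ring

end IsNonlinearMarkovTriple

end CurveToPath

/-! ### Euclidean continuity and finiteness of the transport distance. -/

section LocalContinuity

variable {X : Type*} [Fintype X] [DecidableEq X] {K : (X → ℝ) → X → ℝ}
  {Q : (X → ℝ) → X → X → ℝ}

/-- Continuity and finiteness of the set of pairs. It serves twice: for edge weights near a strictly
positive measure, and for rates near an arbitrary one. -/
lemma exists_forall_le_of_pos {h : X → X → (X → ℝ) → ℝ}
    (hc : ∀ x y, x ≠ y → ContinuousOn (h x y) (stdSimplex ℝ X)) {μ₀ : X → ℝ}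
    (hμ₀ : μ₀ ∈ stdSimplex ℝ X) :
    ∃ c > 0, ∃ r > 0, ∀ μ ∈ stdSimplex ℝ X, dist μ μ₀ < r → ∀ x y, x ≠ y → 0 < h x y μ₀ →
      c ≤ h x y μ := by
  have h1 : ∀ p : X × X, ∃ c > 0, ∀ᶠ μ in 𝓝[stdSimplex ℝ X] μ₀,
      p.1 ≠ p.2 → 0 < h p.1 p.2 μ₀ → c ≤ h p.1 p.2 μ := by
    intro p
    by_cases hp : p.1 ≠ p.2 ∧ 0 < h p.1 p.2 μ₀
    · refine ⟨h p.1 p.2 μ₀ / 2, by linarith [hp.2], ?_⟩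
      filter_upwards [(hc p.1 p.2 hp.1 μ₀ hμ₀).eventually (lt_mem_nhds (half_lt_self hp.2))]
        with μ hμ _ _ using hμ.le
    · exact ⟨1, one_pos, Eventually.of_forall fun μ h2 h3 => (hp ⟨h2, h3⟩).elim⟩
  choose c hc0 hev using h1
  have hne : Nonempty (X × X) := by
    by_contra hX
    have hX' : IsEmpty X := ⟨fun x => hX ⟨(x, x)⟩⟩
    have := hμ₀.2
    simp at this
  obtain ⟨r, hr, hball⟩ := Metric.mem_nhdsWithin_iff.1 (eventually_all.2 hev)
  obtain ⟨p₀, -, hp₀⟩ := Finset.exists_min_image Finset.univ c Finset.univ_nonempty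
  exact ⟨c p₀, hc0 p₀, r, hr, fun μ hμ hd x y hxy hpos =>
    (hp₀ (x, y) (Finset.mem_univ _)).trans (hball ⟨hd, hμ⟩ (x, y) hxy hpos)⟩

lemma exists_mem_compl_of_reflTransGen {R : X → X → Prop}
    (hR : ∀ x y, Relation.ReflTransGen R x y) {S : Finset X} (hS : S.Nonempty)
    (hu : S ≠ Finset.univ) : ∃ x ∈ S, ∃ y ∈ Sᶜ, R x y := by
  obtain ⟨a, ha⟩ := hS
  obtain ⟨b, hb⟩ : ∃ b, b ∉ S := by
    by_contra! h
    exact hu (Finset.eq_univ_iff_forall.2 h)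
  by_contra! hno
  have : ∀ z, Relation.ReflTransGen R a z → z ∈ S := by
    intro z hz
    induction hz with
    | refl => exact ha
    | tail _ hyz ih =>
      by_contra hz
      exact hno _ ih _ (Finset.mem_compl.2 hz) hyz
  exact hb (this b (hR a b))

lemma gibbsMeasure_pos (K : (X → ℝ) → X → ℝ) (μ : X → ℝ) (x : X) : 0 < gibbsMeasure K μ x :=
  div_pos (Real.exp_pos _) (Finset.sum_pos (fun _ _ => Real.exp_pos _) ⟨x, Finset.mem_univ x⟩)

namespace IsNonlinearMarkovTriple

variable (hQ : IsNonlinearMarkovTriple K Q)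
include hQ

lemma rate_pos_comm {μ : X → ℝ} (hμ : μ ∈ stdSimplex ℝ X) {x y : X} (h : 0 < Q μ x y) :
    0 < Q μ y x := by
  have hb := hQ.detailed_balance μ hμ x y
  have h1 := mul_pos (gibbsMeasure_pos K μ x) h
  rw [hb] at h1
  exact (mul_pos_iff_of_pos_left (gibbsMeasure_pos K μ y)).1 h1

lemma edgeWeight_pos {μ : X → ℝ} (hμ : μ ∈ stdSimplex ℝ X) (hpos : ∀ x, 0 < μ x) {x y : X}
    (h : 0 < Q μ x y) : 0 < edgeWeight Q μ x y :=
  logMean_pos (mul_pos (hpos x) h) (mul_pos (hpos y) (hQ.rate_pos_comm hμ h))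

lemma isConnecting_edgeWeight {μ : X → ℝ} (hμ : μ ∈ stdSimplex ℝ X) (hpos : ∀ x, 0 < μ x) :
    IsConnecting (edgeWeight Q μ) := by
  intro S hS hu
  obtain ⟨x, hx, y, hy, hxy⟩ := exists_mem_compl_of_reflTransGen (hQ.irreducible μ hμ) hS hu
  exact ⟨x, hx, y, hy, hQ.edgeWeight_pos hμ hpos hxy⟩

/-- Near a strictly positive measure the transport distance is bounded by the Euclidean one. -/
lemma exists_transportDist_le_of_pos {μ₀ : X → ℝ} (hμ₀ : μ₀ ∈ stdSimplex ℝ X)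
    (hpos : ∀ x, 0 < μ₀ x) : ∃ M > 0, ∃ r > 0, ∀ μ ∈ stdSimplex ℝ X, dist μ μ₀ < r →
      transportDist Q μ₀ μ ≤ ENNReal.ofReal (M * dist μ μ₀) := by
  obtain ⟨C, hC, hCb⟩ := hQ.exists_edgeWeight_le
  obtain ⟨c, hc, r, hr, hcr⟩ := exists_forall_le_of_pos
    (h := fun x y μ => edgeWeight Q μ x y) (fun _ _ hxy => hQ.continuousOn_edgeWeight hxy) hμ₀
  set n : ℝ := (Fintype.card X : ℝ) with hn
  have hn0 : 0 ≤ n := by positivity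
  -- The first term is the square root of the energy bound of `exists_isPath_of_cut_le` with `g = n
  -- / c * d`, divided by `d`; the `1` secures positivity.
  refine ⟨n ^ 2 * √C * (n / c) + 1, by positivity, r, hr, fun μ hμ hd => ?_⟩
  set d := dist μ μ₀ with hddef
  have hd0 : 0 ≤ d := dist_nonneg
  have hs : ∀ t ∈ Icc (0 : ℝ) 1, (fun x => μ₀ x + t * (μ x - μ₀ x)) ∈ stdSimplex ℝ X := by
    intro t ht
    have := (convex_stdSimplex ℝ X).add_smul_sub_mem hμ₀ hμ ht
    exact this
  have hdist : ∀ t ∈ Icc (0 : ℝ) 1, dist (fun x => μ₀ x + t * (μ x - μ₀ x)) μ₀ < r := by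
    intro t ht
    refine lt_of_le_of_lt ((dist_pi_le_iff hd0).2 fun x => ?_) hd
    rw [Real.dist_eq, add_sub_cancel_left, abs_mul, abs_of_nonneg ht.1]
    calc t * |μ x - μ₀ x| ≤ 1 * |μ x - μ₀ x| := mul_le_mul_of_nonneg_right ht.2 (abs_nonneg _)
      _ ≤ d := by rw [one_mul, ← Real.dist_eq]; exact dist_le_pi_dist μ μ₀ x
  have hedge : ∀ t ∈ Icc (0 : ℝ) 1, ∀ S : Finset X, S.Nonempty → S ≠ Finset.univ →
      ∃ x ∈ S, ∃ y ∈ Sᶜ, c ≤ edgeWeight Q (fun x => μ₀ x + t * (μ x - μ₀ x)) x y := by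
    intro t ht S hS hu
    obtain ⟨x, hx, y, hy, hxy⟩ := hQ.isConnecting_edgeWeight hμ₀ hpos S hS hu
    exact ⟨x, hx, y, hy, hcr _ (hs t ht) (hdist t ht) x y
      (fun h => Finset.mem_compl.1 hy (h ▸ hx)) hxy⟩
  have hsum0 : ∑ x, (μ x - μ₀ x) = 0 := by
    rw [Finset.sum_sub_distrib, hμ.2, hμ₀.2, sub_self]
  -- Along the straight segment the flow through a cut is at most `n * d`, while some crossing edge
  -- has weight at least `c`; hence the choice of `g`.
  obtain ⟨ψ, hp, hE⟩ := hQ.exists_isPath_of_cut_le (T := 1) hC.le hCb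
    (μ := fun t x => μ₀ x + t * (μ x - μ₀ x)) (v := fun _ x => μ x - μ₀ x)
    (g := fun _ => n / c * d)
    (fun t x => (((hasDerivAt_id t).mul_const _).const_add _).congr_deriv (one_mul _))
    (fun x => continuous_const) (fun _ => hsum0) hs
    (fun t ht S hS hu => by
      obtain ⟨x, hx, y, hy, hxy⟩ := hedge t (Ioo_subset_Icc_self ht) S hS hu
      exact ⟨x, hx, y, hy, hc.trans_le hxy⟩)
    (fun t _ => by positivity) (integrableOn_const (by simp))
    (fun t ht S => by
      rcases S.eq_empty_or_nonempty with rfl | hS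
      · simp
      by_cases hu : S = Finset.univ
      · simp [hu, hsum0]
      obtain ⟨x, hx, y, hy, hxy⟩ := hedge t (Ioo_subset_Icc_self ht) S hS hu
      have hcut : c ≤ ∑ x ∈ S, ∑ y ∈ Sᶜ,
          edgeWeight Q (fun x => μ₀ x + t * (μ x - μ₀ x)) x y := by
        have hne : ∀ x ∈ S, ∀ y ∈ Sᶜ,
            0 ≤ edgeWeight Q (fun x => μ₀ x + t * (μ x - μ₀ x)) x y := fun x hx y hy =>
          hQ.edgeWeight_nonneg (hs t (Ioo_subset_Icc_self ht))
            fun h => Finset.mem_compl.1 hy (h ▸ hx)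
        refine hxy.trans ((Finset.single_le_sum (hne x hx) hy).trans ?_)
        exact Finset.single_le_sum (f := fun x => ∑ y ∈ Sᶜ,
          edgeWeight Q (fun x => μ₀ x + t * (μ x - μ₀ x)) x y)
          (fun x hx => Finset.sum_nonneg (hne x hx)) hx
      have hv : |∑ x ∈ S, (μ x - μ₀ x)| ≤ n * d := by
        refine (Finset.abs_sum_le_sum_abs _ _).trans ?_
        calc ∑ x ∈ S, |μ x - μ₀ x| ≤ ∑ x, |μ x - μ₀ x| :=
              Finset.sum_le_univ_sum_of_nonneg fun x => abs_nonneg _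
          _ ≤ ∑ _x : X, d := Finset.sum_le_sum fun x _ => by
              rw [← Real.dist_eq]; exact dist_le_pi_dist μ μ₀ x
          _ = n * d := by simp [hn]
      refine hv.trans ?_
      calc n * d = n / c * d * c := by field_simp
        _ ≤ _ := mul_le_mul_of_nonneg_left hcut (by positivity))
  have h := hQ.transportDist_le (by norm_num : (0 : ℝ) < 1) hp (r := n ^ 2 * √C * (n / c) * d)
    (by positivity) (by
      simp only [sub_zero, ENNReal.ofReal_one, one_mul]
      refine hE.trans (le_of_eq ?_)
      simp only [lintegral_const, Measure.restrict_apply MeasurableSet.univ, univ_inter,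
        Real.volume_Ioo, sub_zero, ENNReal.ofReal_one, mul_one]
      congr 1
      rw [← hn]
      linear_combination (-(n ^ 4 * (n / c) ^ 2 * d ^ 2)) * Real.sq_sqrt hC.le)
  simp only [zero_mul, add_zero, one_mul, add_sub_cancel] at h
  refine h.trans (ENNReal.ofReal_le_ofReal ?_)
  nlinarith

end IsNonlinearMarkovTriple

/-- The edge weights `1 / |X|` on the edges of `Q(μ₀)`. -/
def uniformWeight (Q : (X → ℝ) → X → X → ℝ) (μ₀ : X → ℝ) (x y : X) : ℝ :=
  if x ≠ y ∧ 0 < Q μ₀ x y then (Fintype.card X : ℝ)⁻¹ else 0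

namespace IsNonlinearMarkovTriple

variable (hQ : IsNonlinearMarkovTriple K Q)
include hQ

lemma uniformWeight_comm {μ₀ : X → ℝ} (hμ₀ : μ₀ ∈ stdSimplex ℝ X) (x y : X) :
    uniformWeight Q μ₀ x y = uniformWeight Q μ₀ y x := by
  have h : (x ≠ y ∧ 0 < Q μ₀ x y) ↔ (y ≠ x ∧ 0 < Q μ₀ y x) :=
    ⟨fun h => ⟨h.1.symm, hQ.rate_pos_comm hμ₀ h.2⟩, fun h => ⟨h.1.symm, hQ.rate_pos_comm hμ₀ h.2⟩⟩
  simp only [uniformWeight, h]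

lemma isConnecting_uniformWeight {μ₀ : X → ℝ} (hμ₀ : μ₀ ∈ stdSimplex ℝ X) :
    IsConnecting (uniformWeight Q μ₀) := by
  intro S hS hu
  obtain ⟨x, hx, y, hy, hxy⟩ := exists_mem_compl_of_reflTransGen (hQ.irreducible μ₀ hμ₀) hS hu
  have hne : x ≠ y := fun h => Finset.mem_compl.1 hy (h ▸ hx)
  have : 0 < Fintype.card X := Fintype.card_pos_iff.2 ⟨x⟩
  refine ⟨x, hx, y, hy, ?_⟩
  rw [uniformWeight, if_pos ⟨hne, hxy⟩]
  positivity

omit hQ in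
-- A point has at most `|X| - 1` neighbours. The slack `1 / |X|` serves as the retained share `δ` of
-- the diffusion.
lemma sum_uniformWeight_le (Q : (X → ℝ) → X → X → ℝ) (μ₀ : X → ℝ) (x : X) :
    ∑ y, uniformWeight Q μ₀ x y ≤ 1 - (Fintype.card X : ℝ)⁻¹ := by
  have hcard : 0 < Fintype.card X := Fintype.card_pos_iff.2 ⟨x⟩
  have hn : (0 : ℝ) < Fintype.card X := by exact_mod_cast hcard
  have h0 : uniformWeight Q μ₀ x x = 0 := by simp [uniformWeight]
  rw [← Finset.sum_erase Finset.univ h0]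
  calc ∑ y ∈ Finset.univ.erase x, uniformWeight Q μ₀ x y
      ≤ ∑ _y ∈ Finset.univ.erase x, (Fintype.card X : ℝ)⁻¹ := by
        refine Finset.sum_le_sum fun y _ => ?_
        rw [uniformWeight]
        split_ifs
        · exact le_rfl
        · positivity
    _ = 1 - (Fintype.card X : ℝ)⁻¹ := by
        rw [Finset.sum_const, Finset.card_erase_of_mem (Finset.mem_univ x), Finset.card_univ,
          nsmul_eq_mul, Nat.cast_sub hcard]
        field_simp
        simp

/-- Near any measure there is a deformation into the interior of the simplex which costs little. -/
lemma exists_deformation {μ₀ : X → ℝ} (hμ₀ : μ₀ ∈ stdSimplex ℝ X) :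
    ∃ B > 0, ∃ r > 0, ∃ τ₀ > 0, ∃ Φ : ℝ → (X → ℝ) → X → ℝ, (∀ τ, Continuous (Φ τ)) ∧
      ∀ μ ∈ stdSimplex ℝ X, dist μ μ₀ < r → ∀ τ ∈ Ioo 0 τ₀, Φ τ μ ∈ stdSimplex ℝ X ∧
        (∀ x, 0 < Φ τ μ x) ∧ transportDist Q μ (Φ τ μ) ≤ ENNReal.ofReal √(τ * B) := by
  obtain ⟨C, hC, hCb⟩ := hQ.exists_edgeWeight_le
  obtain ⟨c, hc, r, hr, hcr⟩ := exists_forall_le_of_pos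
    (h := fun x y μ => Q μ x y) (fun x y _ => hQ.continuousOn_rate x y) hμ₀
  have hcard : 0 < Fintype.card X := by
    rw [Fintype.card_pos_iff]
    by_contra hX
    rw [not_nonempty_iff] at hX
    have := hμ₀.2
    simp at this
  set n : ℕ := Fintype.card X with hn
  set w := uniformWeight Q μ₀ with hw
  set δ : ℝ := (n : ℝ)⁻¹ with hδdef
  have hn0 : (0 : ℝ) < n := by exact_mod_cast hcard
  have hδ0 : 0 < δ := inv_pos.2 hn0
  have hsymm : ∀ x y, w x y = w y x := hQ.uniformWeight_comm hμ₀
  have hwδ : ∀ x y, w x y = 0 ∨ δ ≤ w x y := fun x y => by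
    rw [hw, uniformWeight]
    split_ifs
    · exact Or.inr le_rfl
    · exact Or.inl rfl
  have hw0 : ∀ x y, 0 ≤ w x y := fun x y => by
    rcases hwδ x y with h | h
    · exact h.ge
    · exact hδ0.le.trans h
  have hwsum : ∀ x, ∑ y, w x y ≤ 1 - δ := sum_uniformWeight_le Q μ₀
  have hδ1 : δ ≤ 1 := by
    have x₀ : X := Classical.choice (Fintype.card_pos_iff.1 hcard)
    have := (Finset.sum_nonneg fun y _ => hw0 x₀ y).trans (hwsum x₀)
    linarith
  -- For small times and starting points near `μ₀` the whole flow stays in the ball of radius `r`,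
  -- where rates along the edges of `Q μ₀` are at least `c`.
  obtain ⟨ρ, hρ, hball⟩ := Metric.continuousAt_iff.1
    ((continuous_iterate_diffusionStep w (n + 1)).continuousAt (x := ((0 : ℝ), μ₀))) r hr
  simp only [iterate_diffusionStep_zero] at hball
  have hmem : ∀ k, ∀ t ∈ Icc (0 : ℝ) 1, ∀ μ ∈ stdSimplex ℝ X,
      (diffusionStep w t)^[k] μ ∈ stdSimplex ℝ X := fun k t ht μ hμ =>
    iterate_diffusionStep_mem_stdSimplex hsymm hδ0.le hwsum hw0 ht hμ k
  -- Some point carries mass at least `1 / n = δ`, and `n` steps spread it everywhere.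
  have hlow : ∀ t ∈ Icc (0 : ℝ) 1, ∀ μ ∈ stdSimplex ℝ X, ∀ x,
      (δ * t) ^ n * δ ≤ (diffusionStep w t)^[n] μ x := by
    intro t ht μ hμ x
    obtain ⟨x₀, -, hx₀⟩ := Finset.exists_max_image Finset.univ μ ⟨x, Finset.mem_univ x⟩
    refine le_iterate_diffusionStep hsymm hδ0 hwsum hwδ
      (hQ.isConnecting_uniformWeight hμ₀) ht hμ hδ0.le (x₀ := x₀) ?_ x
    have h1 : ∑ x, μ x ≤ ∑ _x : X, μ x₀ := Finset.sum_le_sum fun x _ => hx₀ x (Finset.mem_univ x)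
    rw [hμ.2, Finset.sum_const, Finset.card_univ, nsmul_eq_mul, ← hn] at h1
    rw [hδdef, inv_le_iff_one_le_mul₀ hn0]
    linarith
  have hstep : ∀ t ∈ Icc (0 : ℝ) 1, ∀ μ ∈ stdSimplex ℝ X, ∀ x,
      δ * (diffusionStep w t)^[n] μ x ≤ (diffusionStep w t)^[n + 1] μ x := by
    intro t ht μ hμ x
    rw [Function.iterate_succ_apply']
    refine le_trans ?_ (le_diffusionStep hwsum hw0 ht (hmem n t ht μ hμ).1 x)
    have := mul_nonneg ht.1 (Finset.sum_nonneg fun y (_ : y ∈ Finset.univ) =>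
      mul_nonneg (hw0 x y) ((hmem n t ht μ hμ).1 y))
    linarith
  have hpos : ∀ t ∈ Ioc (0 : ℝ) 1, ∀ μ ∈ stdSimplex ℝ X, ∀ x,
      0 < (diffusionStep w t)^[n] μ x := fun t ht μ hμ x =>
    lt_of_lt_of_le (by have := ht.1; positivity) (hlow t ⟨ht.1.le, ht.2⟩ μ hμ x)
  have hpos' : ∀ t ∈ Ioc (0 : ℝ) 1, ∀ μ ∈ stdSimplex ℝ X, ∀ x,
      0 < (diffusionStep w t)^[n + 1] μ x := fun t ht μ hμ x =>
    (mul_pos hδ0 (hpos t ht μ hμ x)).trans_le (hstep t ⟨ht.1.le, ht.2⟩ μ hμ x)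
  -- The flow through an edge is at most `n + 1` times the logarithmic mean of the values of the
  -- `n`-th iterate times their logarithmic difference. The edge weight at the next iterate is at
  -- least `c * δ` times the same mean. The last factor bounds the logarithmic difference, up to a
  -- power of `t`.
  set A : ℝ := (n + 1) / (c * δ) * ((n + 1) * (-Real.log δ) + 4 * n) with hA
  have hlogδ : 0 ≤ -Real.log δ := neg_nonneg.2 (Real.log_nonpos hδ0.le hδ1)
  have hA0 : 0 ≤ A := by positivity
  -- The lower bound `hlow` gives `O(log(1/t))`, absorbed into `t ^ (-1/4)`. The exponent is chosen
  -- so that its square is still integrable at `0`.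
  have hlogs : ∀ t ∈ Ioc (0 : ℝ) 1, ∀ μ ∈ stdSimplex ℝ X, ∀ x y,
      |Real.log ((diffusionStep w t)^[n] μ x) - Real.log ((diffusionStep w t)^[n] μ y)| ≤
        ((n + 1) * (-Real.log δ) + 4 * n) * t ^ (-(1 / 4) : ℝ) := by
    intro t ht μ hμ
    have ht' : t ∈ Icc (0 : ℝ) 1 := ⟨ht.1.le, ht.2⟩
    have h1 : ∀ x, Real.log ((diffusionStep w t)^[n] μ x) ≤ 0 := fun x =>
      Real.log_nonpos ((hmem n t ht' μ hμ).1 x)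
        (mem_Icc_of_mem_stdSimplex (hmem n t ht' μ hμ) x).2
    have hroot : 1 ≤ t ^ (-(1 / 4) : ℝ) :=
      Real.one_le_rpow_of_pos_of_le_one_of_nonpos ht.1 ht.2 (by norm_num)
    have hlogt : -Real.log t ≤ 4 * t ^ (-(1 / 4) : ℝ) := by
      have h2 := Real.log_le_rpow_div (x := t⁻¹) (inv_nonneg.2 ht.1.le)
        (by norm_num : (0 : ℝ) < 1 / 4)
      rw [Real.log_inv, Real.inv_rpow ht.1.le, ← Real.rpow_neg ht.1.le] at h2
      linarith
    have h2 : ∀ x, -Real.log ((diffusionStep w t)^[n] μ x) ≤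
        ((n + 1) * (-Real.log δ) + 4 * n) * t ^ (-(1 / 4) : ℝ) := by
      intro x
      have h3 := Real.log_le_log (by have := ht.1; positivity) (hlow t ht' μ hμ x)
      rw [Real.log_mul (by have := ht.1; positivity) hδ0.ne', Real.log_pow,
        Real.log_mul hδ0.ne' ht.1.ne'] at h3
      have h4 := mul_le_mul_of_nonneg_left hlogt hn0.le
      have h5 := mul_le_mul_of_nonneg_left hroot
        (by positivity : 0 ≤ ((n : ℝ) + 1) * (-Real.log δ))
      linarith
    intro x y
    rw [abs_le]
    constructor
    · linarith [h1 y, h2 x]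
    · linarith [h1 x, h2 y]
  -- An energy bound for the flow that does not depend on the starting measure; over a time `τ` the
  -- squared cost is then at most `τ * (J + 1)`.
  set J : ℝ≥0∞ := ∫⁻ t in Ioo (0 : ℝ) 1,
    ENNReal.ofReal ((n : ℝ) ^ 4 * C * (A * t ^ (-(1 / 4) : ℝ)) ^ 2) with hJ
  have hJtop : J < ⊤ := by
    have hi : IntegrableOn (fun t : ℝ => (n : ℝ) ^ 4 * C * A ^ 2 * t ^ (-(1 / 2) : ℝ))
        (Ioo 0 1) :=
      ((intervalIntegral.integrableOn_Ioo_rpow_iff one_pos).2 (by norm_num)).const_mul _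
    refine lt_of_le_of_lt (le_of_eq ?_) hi.lintegral_lt_top
    refine setLIntegral_congr_fun measurableSet_Ioo fun t ht => ?_
    congr 1
    have : (t ^ (-(1 / 4) : ℝ)) ^ 2 = t ^ (-(1 / 2) : ℝ) := by
      rw [← Real.rpow_natCast, ← Real.rpow_mul ht.1.le]
      norm_num
    rw [mul_pow, this]
    ring
  refine ⟨J.toReal + 1, by positivity, min ρ 1, lt_min hρ one_pos, min ρ 1, lt_min hρ one_pos,
    fun τ => (diffusionStep w τ)^[n + 1], fun τ => ?_, fun μ hμ hd τ hτ => ?_⟩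
  · exact (continuous_iterate_diffusionStep w (n + 1)).comp (continuous_const.prodMk continuous_id)
  have hτ1 : τ < 1 := hτ.2.trans_le (min_le_right _ _)
  have hsub : ∀ t ∈ Icc 0 τ, t ∈ Icc (0 : ℝ) 1 := fun t ht => ⟨ht.1, ht.2.trans hτ1.le⟩
  have hsub' : ∀ t ∈ Ioo 0 τ, t ∈ Ioc (0 : ℝ) 1 := fun t ht => ⟨ht.1, (ht.2.trans hτ1).le⟩
  have hnear : ∀ t ∈ Icc 0 τ, dist ((diffusionStep w t)^[n + 1] μ) μ₀ < r := by
    intro t ht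
    refine hball (x := (t, μ)) ?_
    rw [Prod.dist_eq, max_lt_iff, Real.dist_eq, sub_zero, abs_of_nonneg ht.1]
    exact ⟨ht.2.trans_lt (hτ.2.trans_le (min_le_left _ _)), hd.trans_le (min_le_left _ _)⟩
  have hτm : τ ∈ Ioc (0 : ℝ) 1 := ⟨hτ.1, hτ1.le⟩
  refine ⟨hmem _ τ ⟨hτ.1.le, hτ1.le⟩ μ hμ, hpos' τ hτm μ hμ, ?_⟩
  obtain ⟨ψ, hp, hE⟩ := hQ.exists_isPath_of_cut_le (T := τ) hC.le hCb
    (μ := fun t => (diffusionStep w t)^[n + 1] μ)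
    (v := fun t x => (n + 1) * graphLaplacian w ((diffusionStep w t)^[n] μ) x)
    (g := fun t => A * t ^ (-(1 / 4) : ℝ))
    (fun t x => hasDerivAt_iterate_diffusionStep w μ n t x)
    (fun x => by
      have h1 : Continuous fun t : ℝ => (diffusionStep w t)^[n] μ :=
        (continuous_iterate_diffusionStep w n).comp (continuous_id.prodMk continuous_const)
      simp only [graphLaplacian]
      fun_prop)
    (fun t => by
      rw [← Finset.mul_sum]
      simp only [graphLaplacian, sum_laplace_eq_zero hsymm, mul_zero])
    (fun t ht => hmem _ t (hsub t ht) μ hμ)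
    (fun t ht => hQ.isConnecting_edgeWeight (hmem _ t (hsub t (Ioo_subset_Icc_self ht)) μ hμ)
      (hpos' t (hsub' t ht) μ hμ))
    (fun t ht => mul_nonneg hA0 (Real.rpow_nonneg ht.1.le _))
    (((intervalIntegral.integrableOn_Ioo_rpow_iff hτ.1).2 (by norm_num)).const_mul _)
    (fun t ht S => by
      have htm := hsub' t ht
      have htI := hsub t (Ioo_subset_Icc_self ht)
      have hedge : ∀ x ∈ S, ∀ y ∈ Sᶜ, |(n + 1) * (w x y * ((diffusionStep w t)^[n] μ y -
          (diffusionStep w t)^[n] μ x))| ≤ A * t ^ (-(1 / 4) : ℝ) *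
            edgeWeight Q ((diffusionStep w t)^[n + 1] μ) x y := by
        intro x hx y hy
        have hne : x ≠ y := fun h => Finset.mem_compl.1 hy (h ▸ hx)
        have hEn := hQ.edgeWeight_nonneg (hmem (n + 1) t htI μ hμ) hne
        have hgn : 0 ≤ A * t ^ (-(1 / 4) : ℝ) := mul_nonneg hA0 (Real.rpow_nonneg ht.1.le _)
        by_cases hxy : 0 < Q μ₀ x y
        swap
        · have : w x y = 0 := by rw [hw, uniformWeight, if_neg fun h => hxy h.2]
          rw [this]
          simpa using mul_nonneg hgn hEn
        have hwle : w x y ≤ 1 := by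
          rw [hw, uniformWeight, if_pos ⟨hne, hxy⟩]
          exact hδ1
        have hqx := hcr _ (hmem _ t htI μ hμ) (hnear t (Ioo_subset_Icc_self ht)) x y hne hxy
        have hqy := hcr _ (hmem _ t htI μ hμ) (hnear t (Ioo_subset_Icc_self ht)) y x hne.symm
          (hQ.rate_pos_comm hμ₀ hxy)
        have hx0 := hpos t htm μ hμ x
        have hy0 := hpos t htm μ hμ y
        have hx1 := hstep t htI μ hμ x
        have hy1 := hstep t htI μ hμ y
        have hlog := hlogs t htm μ hμ x y
        -- The `(n + 1)`-th iterate dominates `δ` times the `n`-th and the rates are at least `c`;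
        -- monotonicity and homogeneity of the logarithmic mean conclude.
        have hmono : c * δ * logMean ((diffusionStep w t)^[n] μ x) ((diffusionStep w t)^[n] μ y) ≤
            edgeWeight Q ((diffusionStep w t)^[n + 1] μ) x y := by
          rw [← logMean_mul (by positivity) hx0.le hy0.le]
          refine logMean_mono (by positivity) (by positivity) ?_ ?_
          · calc c * δ * (diffusionStep w t)^[n] μ x = δ * (diffusionStep w t)^[n] μ x * c := by ring
              _ ≤ _ := mul_le_mul hx1 hqx hc.le ((mul_pos hδ0 hx0).le.trans hx1)
          · calc c * δ * (diffusionStep w t)^[n] μ y = δ * (diffusionStep w t)^[n] μ y * c := by ring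
              _ ≤ _ := mul_le_mul hy1 hqy hc.le ((mul_pos hδ0 hy0).le.trans hy1)
        have hlm := logMean_mul_log_sub_log hx0 hy0
        have hlm0 := logMean_nonneg hx0.le hy0.le
        set lx := (diffusionStep w t)^[n] μ x
        set ly := (diffusionStep w t)^[n] μ y
        have habs : |ly - lx| = logMean lx ly * |Real.log lx - Real.log ly| := by
          rw [abs_sub_comm, ← hlm, abs_mul, abs_of_nonneg hlm0]
        rw [abs_mul, abs_mul, abs_of_nonneg (hw0 x y), abs_of_nonneg (by positivity), habs]
        set s : ℝ := t ^ (-(1 / 4) : ℝ)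
        have hs0 : 0 ≤ s := Real.rpow_nonneg ht.1.le _
        calc ((n : ℝ) + 1) * (w x y * (logMean lx ly * |Real.log lx - Real.log ly|))
            ≤ (n + 1) * (1 * (logMean lx ly * (((n + 1) * (-Real.log δ) + 4 * n) * s))) := by
              gcongr
          _ = A * s * (c * δ * logMean lx ly) := by
              rw [hA]
              field_simp
          _ ≤ _ := mul_le_mul_of_nonneg_left hmono hgn
      have hflow : ∑ x ∈ S, (n + 1) * graphLaplacian w ((diffusionStep w t)^[n] μ) x =
          ∑ x ∈ S, ∑ y ∈ Sᶜ, (n + 1) * (w x y * ((diffusionStep w t)^[n] μ y -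
            (diffusionStep w t)^[n] μ x)) := by
        rw [← sum_sum_eq_cut (f := fun x y => (n + 1) * (w x y * ((diffusionStep w t)^[n] μ y -
            (diffusionStep w t)^[n] μ x))) (fun x y => by rw [hsymm y x]; ring)]
        simp only [graphLaplacian, Finset.mul_sum]
      rw [hflow, Finset.mul_sum]
      refine (Finset.abs_sum_le_sum_abs _ _).trans (Finset.sum_le_sum fun x hx => ?_)
      rw [Finset.mul_sum]
      exact (Finset.abs_sum_le_sum_abs _ _).trans (Finset.sum_le_sum fun y hy => hedge x hx y hy))
  have hEJ : energy Q 0 τ (fun t => (diffusionStep w t)^[n + 1] μ) ψ ≤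
      ENNReal.ofReal (J.toReal + 1) := by
    refine (hE.trans (lintegral_mono_set (Ioo_subset_Ioo_right hτ1.le))).trans ?_
    rw [← hJ]
    calc J = ENNReal.ofReal J.toReal := (ENNReal.ofReal_toReal hJtop.ne).symm
      _ ≤ _ := ENNReal.ofReal_le_ofReal (by linarith)
  have h := hQ.transportDist_le hτ.1 hp (r := √(τ * (J.toReal + 1))) (Real.sqrt_nonneg _) (by
    have : 0 ≤ τ * (J.toReal + 1) := mul_nonneg hτ.1.le (by positivity)
    rw [Real.sq_sqrt this, sub_zero, ENNReal.ofReal_mul hτ.1.le]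
    exact mul_le_mul_right hEJ _)
  rwa [iterate_diffusionStep_zero] at h

/-- The transport distance is continuous with respect to the Euclidean topology. -/
theorem eventually_transportDist_lt {μ₀ : X → ℝ} (hμ₀ : μ₀ ∈ stdSimplex ℝ X) {ε : ℝ}
    (hε : 0 < ε) : ∀ᶠ μ in 𝓝[stdSimplex ℝ X] μ₀, transportDist Q μ₀ μ < ENNReal.ofReal ε := by
  obtain ⟨B, hB, r, hr, τ₀, hτ₀, Φ, hΦ, h⟩ := hQ.exists_deformation hμ₀
  -- With this `τ` a deformation costs at most `ε / 4`. The route `μ₀ → Φ τ μ₀ → Φ τ μ → μ` has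
  -- three legs of cost at most `ε / 4`, the middle one lying near a strictly positive measure.
  set τ : ℝ := min (τ₀ / 2) ((ε / 4) ^ 2 / B) with hτdef
  have hτ : τ ∈ Ioo 0 τ₀ :=
    ⟨lt_min (by positivity) (by positivity), (min_le_left _ _).trans_lt (half_lt_self hτ₀)⟩
  have hsqrt : √(τ * B) ≤ ε / 4 := by
    rw [← Real.sqrt_sq (by positivity : (0 : ℝ) ≤ ε / 4)]
    refine Real.sqrt_le_sqrt ?_
    calc τ * B ≤ (ε / 4) ^ 2 / B * B := mul_le_mul_of_nonneg_right (min_le_right _ _) hB.le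
      _ = _ := by field_simp
  obtain ⟨hm, hp, hW⟩ := h μ₀ hμ₀ (by simpa using hr) τ hτ
  obtain ⟨M, hM, r', hr', hloc⟩ := hQ.exists_transportDist_le_of_pos hm hp
  have hd : Tendsto (fun μ => dist (Φ τ μ) (Φ τ μ₀)) (𝓝[stdSimplex ℝ X] μ₀) (𝓝 0) := by
    have : Tendsto (fun μ => dist (Φ τ μ) (Φ τ μ₀)) (𝓝 μ₀) (𝓝 (dist (Φ τ μ₀) (Φ τ μ₀))) :=
      (((hΦ τ).dist continuous_const).tendsto μ₀)
    rw [dist_self] at this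
    exact this.mono_left nhdsWithin_le_nhds
  filter_upwards [self_mem_nhdsWithin, nhdsWithin_le_nhds (Metric.ball_mem_nhds μ₀ hr),
    hd.eventually (gt_mem_nhds hr'), hd.eventually (gt_mem_nhds (by positivity : 0 < ε / 4 / M))]
    with μ hμ hμr h1 h2
  obtain ⟨hm', -, hW'⟩ := h μ hμ hμr τ hτ
  have hmid := hloc _ hm' h1
  have hmid' : M * dist (Φ τ μ) (Φ τ μ₀) ≤ ε / 4 := by
    have := mul_le_mul_of_nonneg_left h2.le hM.le
    rwa [mul_div_cancel₀ _ hM.ne'] at this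
  calc transportDist Q μ₀ μ ≤ transportDist Q μ₀ (Φ τ μ₀) + transportDist Q (Φ τ μ₀) μ :=
        hQ.transportDist_triangle _ _ _
    _ ≤ transportDist Q μ₀ (Φ τ μ₀) + (transportDist Q (Φ τ μ₀) (Φ τ μ) +
          transportDist Q (Φ τ μ) μ) := add_le_add le_rfl (hQ.transportDist_triangle _ _ _)
    _ ≤ ENNReal.ofReal (ε / 4) + (ENNReal.ofReal (ε / 4) + ENNReal.ofReal (ε / 4)) := by
        refine add_le_add (hW.trans (ENNReal.ofReal_le_ofReal hsqrt))
          (add_le_add (hmid.trans (ENNReal.ofReal_le_ofReal hmid')) ?_)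
        rw [hQ.transportDist_comm]
        exact hW'.trans (ENNReal.ofReal_le_ofReal hsqrt)
    _ < ENNReal.ofReal ε := by
        rw [← ENNReal.ofReal_add (by positivity) (by positivity),
          ← ENNReal.ofReal_add (by positivity) (by positivity)]
        exact (ENNReal.ofReal_lt_ofReal_iff hε).2 (by linarith)

/-- Being at finite distance is symmetric, transitive and holds locally by continuity; the simplex
is connected. -/
theorem transportDist_lt_top {μ ν : X → ℝ} (hμ : μ ∈ stdSimplex ℝ X) (hν : ν ∈ stdSimplex ℝ X) :
    transportDist Q μ ν < ⊤ := by
  refine (convex_stdSimplex ℝ X).isPreconnected.induction₂ (fun μ ν => transportDist Q μ ν < ⊤)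
    (fun μ hμ => ?_) (fun a b c _ _ _ hab hbc => ?_) (fun a b _ _ hab => ?_) hμ hν
  · filter_upwards [hQ.eventually_transportDist_lt hμ one_pos] with ν hν
    exact hν.trans ENNReal.ofReal_lt_top
  · exact (hQ.transportDist_triangle a b c).trans_lt (ENNReal.add_lt_top.2 ⟨hab, hbc⟩)
  · rwa [hQ.transportDist_comm]

end IsNonlinearMarkovTriple

end LocalContinuity

/-! ### Existence of geodesics. -/

section Geodesics

variable {X : Type*} [Fintype X] [DecidableEq X] {K : (X → ℝ) → X → ℝ}
  {Q : (X → ℝ) → X → X → ℝ}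

namespace IsNonlinearMarkovTriple

variable (hQ : IsNonlinearMarkovTriple K Q)
include hQ

/-- If the value were positive, continuity at `μ` with `ε` equal to it, evaluated at `μ` itself,
would make it smaller than itself. -/
lemma transportDist_self {μ : X → ℝ} (hμ : μ ∈ stdSimplex ℝ X) : transportDist Q μ μ = 0 := by
  by_contra h
  have hpos : 0 < (transportDist Q μ μ).toReal :=
    ENNReal.toReal_pos h (hQ.transportDist_lt_top hμ hμ).ne
  have h1 := (hQ.eventually_transportDist_lt hμ hpos).self_of_nhdsWithin hμ
  rw [ENNReal.ofReal_toReal (hQ.transportDist_lt_top hμ hμ).ne] at h1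
  exact lt_irrefl _ h1

lemma toReal_transportDist_triangle {μ ν ξ : X → ℝ} (hμ : μ ∈ stdSimplex ℝ X)
    (hν : ν ∈ stdSimplex ℝ X) (hξ : ξ ∈ stdSimplex ℝ X) :
    (transportDist Q μ ξ).toReal ≤ (transportDist Q μ ν).toReal + (transportDist Q ν ξ).toReal := by
  rw [← ENNReal.toReal_add (hQ.transportDist_lt_top hμ hν).ne (hQ.transportDist_lt_top hν hξ).ne]
  exact ENNReal.toReal_mono (ENNReal.add_ne_top.2 ⟨(hQ.transportDist_lt_top hμ hν).ne,
    (hQ.transportDist_lt_top hν hξ).ne⟩) (hQ.transportDist_triangle μ ν ξ)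

lemma tendsto_toReal_transportDist_zero {ι : Type*} {l : Filter ι} {m : ι → X → ℝ} {μ : X → ℝ}
    (hm : ∀ i, m i ∈ stdSimplex ℝ X) (hμ : μ ∈ stdSimplex ℝ X) (h : Tendsto m l (𝓝 μ)) :
    Tendsto (fun i => (transportDist Q μ (m i)).toReal) l (𝓝 0) := by
  refine tendsto_order.2 ⟨fun a ha => Eventually.of_forall fun i => ha.trans_le
    ENNReal.toReal_nonneg, fun a ha => ?_⟩
  have h' : Tendsto m l (𝓝[stdSimplex ℝ X] μ) :=
    tendsto_nhdsWithin_iff.2 ⟨h, Eventually.of_forall hm⟩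
  filter_upwards [h'.eventually (hQ.eventually_transportDist_lt hμ ha)] with i hi
  exact (ENNReal.lt_ofReal_iff_toReal_lt (hQ.transportDist_lt_top hμ (hm i)).ne).1 hi

lemma tendsto_toReal_transportDist {ι : Type*} {l : Filter ι} {m m' : ι → X → ℝ} {μ ν : X → ℝ}
    (hm : ∀ i, m i ∈ stdSimplex ℝ X) (hm' : ∀ i, m' i ∈ stdSimplex ℝ X)
    (hμ : μ ∈ stdSimplex ℝ X) (hν : ν ∈ stdSimplex ℝ X) (h : Tendsto m l (𝓝 μ))
    (h' : Tendsto m' l (𝓝 ν)) :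
    Tendsto (fun i => (transportDist Q (m i) (m' i)).toReal) l
      (𝓝 (transportDist Q μ ν).toReal) := by
  have h0 := (hQ.tendsto_toReal_transportDist_zero hm hμ h).add
    (hQ.tendsto_toReal_transportDist_zero hm' hν h')
  rw [add_zero] at h0
  rw [tendsto_iff_dist_tendsto_zero]
  refine squeeze_zero (fun _ => dist_nonneg) (fun i => ?_) h0
  have t1 := hQ.toReal_transportDist_triangle (hm i) hμ (hm' i)
  have t2 := hQ.toReal_transportDist_triangle hμ hν (hm' i)
  have t3 := hQ.toReal_transportDist_triangle hμ (hm i) hν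
  have t4 := hQ.toReal_transportDist_triangle (hm i) (hm' i) hν
  rw [hQ.transportDist_comm (m i) μ] at t1
  rw [hQ.transportDist_comm (m' i) ν] at t4
  rw [Real.dist_eq, abs_le]
  constructor <;> linarith

lemma sq_toReal_transportDist_le {a b : ℝ} (hab : a ≤ b) {μ ψ : ℝ → X → ℝ}
    (h : IsPath Q a b μ ψ) (hE : energy Q a b μ ψ ≠ ⊤) :
    (transportDist Q (μ a) (μ b)).toReal ^ 2 ≤ (b - a) * (energy Q a b μ ψ).toReal := by
  rcases hab.eq_or_lt with rfl | hlt
  · simp [hQ.transportDist_self (h.mem_simplex a ⟨le_rfl, le_rfl⟩)]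
  have hnn : 0 ≤ (b - a) * (energy Q a b μ ψ).toReal :=
    mul_nonneg (sub_nonneg.2 hab) ENNReal.toReal_nonneg
  have h1 := hQ.transportDist_le hlt h (r := √((b - a) * (energy Q a b μ ψ).toReal))
    (Real.sqrt_nonneg _) (by
      rw [Real.sq_sqrt hnn, ENNReal.ofReal_mul (sub_nonneg.2 hab), ENNReal.ofReal_toReal hE])
  have h2 := ENNReal.toReal_le_of_le_ofReal (Real.sqrt_nonneg _) h1
  calc _ ≤ (√((b - a) * (energy Q a b μ ψ).toReal)) ^ 2 :=
        pow_le_pow_left₀ ENNReal.toReal_nonneg h2 2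
    _ = _ := Real.sq_sqrt hnn

/-- Splitting a path at two times. -/
lemma split_le_of_isPath {μ ψ : ℝ → X → ℝ} (h : IsPath Q 0 1 μ ψ) {E : ℝ} (hE0 : 0 ≤ E)
    (hE : energy Q 0 1 μ ψ ≤ ENNReal.ofReal E) {s t : ℝ} (hs : 0 ≤ s) (hst : s ≤ t) (ht : t ≤ 1) :
    (1 - (t - s)) * (transportDist Q (μ s) (μ t)).toReal ^ 2 +
      (t - s) * ((transportDist Q (μ 0) (μ s)).toReal + (transportDist Q (μ t) (μ 1)).toReal) ^ 2 ≤
      (t - s) * (1 - (t - s)) * E := by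
  have hadd : energy Q 0 s μ ψ + energy Q s t μ ψ + energy Q t 1 μ ψ = energy Q 0 1 μ ψ := by
    rw [energy_add_energy hs hst, energy_add_energy (hs.trans hst) ht]
  have htop : energy Q 0 s μ ψ + energy Q s t μ ψ + energy Q t 1 μ ψ ≠ ⊤ := by
    rw [hadd]
    exact ne_top_of_le_ne_top ENNReal.ofReal_ne_top hE
  obtain ⟨h12, h3⟩ := ENNReal.add_ne_top.1 htop
  obtain ⟨h1, h2⟩ := ENNReal.add_ne_top.1 h12
  have hsum : (energy Q 0 s μ ψ).toReal + (energy Q s t μ ψ).toReal + (energy Q t 1 μ ψ).toReal ≤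
      E := by
    rw [← ENNReal.toReal_add h1 h2, ← ENNReal.toReal_add h12 h3, hadd]
    exact ENNReal.toReal_le_of_le_ofReal hE0 hE
  have b1 := hQ.sq_toReal_transportDist_le hs
    (h.mono (Icc_subset_Icc le_rfl (hst.trans ht))) h1
  have b2 := hQ.sq_toReal_transportDist_le hst (h.mono (Icc_subset_Icc hs ht)) h2
  have b3 := hQ.sq_toReal_transportDist_le ht
    (h.mono (Icc_subset_Icc (hs.trans hst) le_rfl)) h3
  rw [sub_zero] at b1
  have n1 : 0 ≤ (energy Q 0 s μ ψ).toReal := ENNReal.toReal_nonneg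
  have n3 : 0 ≤ (energy Q t 1 μ ψ).toReal := ENNReal.toReal_nonneg
  have na : 0 ≤ (transportDist Q (μ 0) (μ s)).toReal := ENNReal.toReal_nonneg
  have nc : 0 ≤ (transportDist Q (μ t) (μ 1)).toReal := ENNReal.toReal_nonneg
  generalize (transportDist Q (μ 0) (μ s)).toReal = a at *
  generalize (transportDist Q (μ s) (μ t)).toReal = b at *
  generalize (transportDist Q (μ t) (μ 1)).toReal = c at *
  generalize (energy Q 0 s μ ψ).toReal = e₁ at *
  generalize (energy Q s t μ ψ).toReal = e₂ at *
  generalize (energy Q t 1 μ ψ).toReal = e₃ at *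
  have ht' : 0 ≤ 1 - t := by linarith
  -- The outer pieces have total duration `1 - (t - s)`; this and `hac` are Cauchy–Schwarz for them
  -- in a form without division, so that `s = 0` and `t = 1` are included.
  have hcross : 2 * (a * c) ≤ s * e₃ + (1 - t) * e₁ := by
    refine (le_abs_self _).trans (abs_le_of_sq_le_sq ?_ (by positivity))
    have : a ^ 2 * c ^ 2 ≤ (s * e₁) * ((1 - t) * e₃) :=
      mul_le_mul b1 b3 (sq_nonneg _) (by positivity)
    nlinarith [sq_nonneg (s * e₃ - (1 - t) * e₁)]
  have hac : (a + c) ^ 2 ≤ (1 - (t - s)) * (e₁ + e₃) := by nlinarith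
  have k1 := mul_le_mul_of_nonneg_left b2 (by linarith : 0 ≤ 1 - (t - s))
  have k2 := mul_le_mul_of_nonneg_left hac (by linarith : 0 ≤ t - s)
  have k3 := mul_le_mul_of_nonneg_left hsum
    (mul_nonneg (by linarith : 0 ≤ t - s) (by linarith : 0 ≤ 1 - (t - s)))
  nlinarith

omit [Fintype X] [DecidableEq X] hQ in
-- With `d` replaced by its lower bound `W - b`, the two sides of `h` differ by exactly `(b - τ * W)
-- ^ 2`. The hypothesis `hb'` gives `b ≤ W`, so that `W - b ≤ d` may be squared.
lemma eq_mul_of_split_le {b d τ W : ℝ} (hW : 0 ≤ W) (hτ : τ ∈ Icc 0 1)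
    (htri : W ≤ b + d) (hb' : b ^ 2 ≤ τ * W ^ 2)
    (h : (1 - τ) * b ^ 2 + τ * d ^ 2 ≤ τ * (1 - τ) * W ^ 2) : b = τ * W := by
  have hbW : b ≤ W := by
    refine (le_abs_self _).trans (abs_le_of_sq_le_sq ?_ hW)
    nlinarith [sq_nonneg W, hτ.2]
  have h1 : (W - b) ^ 2 ≤ d ^ 2 := pow_le_pow_left₀ (by linarith) (by linarith) 2
  have h2 : (b - τ * W) ^ 2 ≤ 0 := by nlinarith [mul_le_mul_of_nonneg_left h1 hτ.1]
  have h3 : b - τ * W = 0 := pow_eq_zero_iff (two_ne_zero) |>.1 (le_antisymm h2 (sq_nonneg _))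
  linarith

/-- Any two measures are joined by a geodesic. -/
theorem exists_isGeodesic {μ ν : X → ℝ} (hμ : μ ∈ stdSimplex ℝ X) (hν : ν ∈ stdSimplex ℝ X) :
    ∃ γ : ℝ → X → ℝ, IsGeodesic Q γ ∧ γ 0 = μ ∧ γ 1 = ν := by
  set W : ℝ := (transportDist Q μ ν).toReal with hWdef
  have hW : 0 ≤ W := ENNReal.toReal_nonneg
  have htop := (hQ.transportDist_lt_top hμ hν).ne
  have hex : ∀ k : ℕ, ∃ m ψ, IsPath Q 0 1 m ψ ∧ m 0 = μ ∧ m 1 = ν ∧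
      energy Q 0 1 m ψ ≤ ENNReal.ofReal ((W + 1 / ((k : ℝ) + 1)) ^ 2) := fun k => by
    refine hQ.exists_path_of_transportDist_lt ?_
    rw [ENNReal.lt_ofReal_iff_toReal_lt htop]
    have : (0 : ℝ) < 1 / ((k : ℝ) + 1) := by positivity
    linarith
  choose m ψ hp h0 h1 hE using hex
  -- By compactness an ultrafilter gives limits at all times at once, without equicontinuity or a
  -- choice of subsequence. Outside `[0, 1]` the value is irrelevant.
  have hlim : ∀ t, ∃ y : X → ℝ, t ∈ Icc (0 : ℝ) 1 → y ∈ stdSimplex ℝ X ∧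
      Tendsto (fun k => m k t) (hyperfilter ℕ) (𝓝 y) := by
    intro t
    by_cases ht : t ∈ Icc (0 : ℝ) 1
    · obtain ⟨y, hy, hle⟩ := (isCompact_stdSimplex ℝ X).ultrafilter_le_nhds
        ((hyperfilter ℕ).map fun k => m k t)
        (le_principal_iff.2 (Filter.mem_map.2
          (Eventually.of_forall fun k => (hp k).mem_simplex t ht)))
      exact ⟨y, fun _ => ⟨hy, hle⟩⟩
    · exact ⟨0, fun h => (ht h).elim⟩
  choose γ hγ using hlim
  have I0 : (0 : ℝ) ∈ Icc (0 : ℝ) 1 := ⟨le_rfl, zero_le_one⟩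
  have I1 : (1 : ℝ) ∈ Icc (0 : ℝ) 1 := ⟨zero_le_one, le_rfl⟩
  have hγ0 : γ 0 = μ := by
    have := (hγ 0 I0).2
    simp only [h0] at this
    exact tendsto_nhds_unique this tendsto_const_nhds
  have hγ1 : γ 1 = ν := by
    have := (hγ 1 I1).2
    simp only [h1] at this
    exact tendsto_nhds_unique this tendsto_const_nhds
  have hElim : Tendsto (fun k : ℕ => (W + 1 / ((k : ℝ) + 1)) ^ 2) (hyperfilter ℕ)
      (𝓝 (W ^ 2)) := by
    have h2 : Tendsto (fun k : ℕ => (W + 1 / ((k : ℝ) + 1)) ^ 2) atTop (𝓝 ((W + 0) ^ 2)) :=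
      (tendsto_const_nhds.add tendsto_one_div_add_atTop_nhds_zero_nat).pow 2
    rw [add_zero] at h2
    exact h2.mono_left Nat.hyperfilter_le_atTop
  have hmain : ∀ s t, 0 ≤ s → s ≤ t → t ≤ 1 →
      (transportDist Q (γ s) (γ t)).toReal = (t - s) * W := by
    intro s t hs hst ht
    have Is : s ∈ Icc (0 : ℝ) 1 := ⟨hs, hst.trans ht⟩
    have It : t ∈ Icc (0 : ℝ) 1 := ⟨hs.trans hst, ht⟩
    have hmem : ∀ {r}, r ∈ Icc (0 : ℝ) 1 → ∀ k, m k r ∈ stdSimplex ℝ X := fun hr k =>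
      (hp k).mem_simplex _ hr
    have htd : ∀ {r r'}, r ∈ Icc (0 : ℝ) 1 → r' ∈ Icc (0 : ℝ) 1 →
        Tendsto (fun k => (transportDist Q (m k r) (m k r')).toReal) (hyperfilter ℕ)
          (𝓝 (transportDist Q (γ r) (γ r')).toReal) := fun hr hr' =>
      hQ.tendsto_toReal_transportDist (hmem hr) (hmem hr') (hγ _ hr).1 (hγ _ hr').1
        (hγ _ hr).2 (hγ _ hr').2
    -- Only distances and total energies pass to the limit: the former by continuity of `W`, the
    -- latter by near optimality.
    have hineq := le_of_tendsto_of_tendsto'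
      ((((htd Is It).pow 2).const_mul (1 - (t - s))).add
        ((((htd I0 Is).add (htd It I1)).pow 2).const_mul (t - s)))
      (hElim.const_mul ((t - s) * (1 - (t - s))))
      fun k => hQ.split_le_of_isPath (hp k) (sq_nonneg _) (hE k) hs hst ht
    have hineq' := le_of_tendsto_of_tendsto' ((htd Is It).pow 2) (hElim.const_mul (t - s)) fun k => by
      have htopk : energy Q 0 1 (m k) (ψ k) ≠ ⊤ :=
        ne_top_of_le_ne_top ENNReal.ofReal_ne_top (hE k)
      have hle : energy Q s t (m k) (ψ k) ≤ energy Q 0 1 (m k) (ψ k) :=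
        lintegral_mono_set (Icc_subset_Icc hs ht)
      refine (hQ.sq_toReal_transportDist_le hst ((hp k).mono (Icc_subset_Icc hs ht))
        (ne_top_of_le_ne_top htopk hle)).trans ?_
      exact mul_le_mul_of_nonneg_left (ENNReal.toReal_le_of_le_ofReal (sq_nonneg _)
        (hle.trans (hE k))) (sub_nonneg.2 hst)
    refine eq_mul_of_split_le hW
      ⟨sub_nonneg.2 hst, by linarith⟩ ?_ hineq' hineq
    have t1 := hQ.toReal_transportDist_triangle (hγ 0 I0).1 (hγ s Is).1 (hγ 1 I1).1
    have t2 := hQ.toReal_transportDist_triangle (hγ s Is).1 (hγ t It).1 (hγ 1 I1).1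
    have t3 : (transportDist Q (γ 0) (γ 1)).toReal = W := by rw [hγ0, hγ1]
    linarith
  have hmainE : ∀ s t, 0 ≤ s → s ≤ t → t ≤ 1 →
      transportDist Q (γ s) (γ t) = ENNReal.ofReal (t - s) * transportDist Q (γ 0) (γ 1) := by
    intro s t hs hst ht
    have hne : transportDist Q (γ s) (γ t) ≠ ⊤ := (hQ.transportDist_lt_top
      (hγ s ⟨hs, hst.trans ht⟩).1 (hγ t ⟨hs.trans hst, ht⟩).1).ne
    rw [hγ0, hγ1, ← ENNReal.ofReal_toReal hne, hmain s t hs hst ht,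
      ENNReal.ofReal_mul (sub_nonneg.2 hst), hWdef, ENNReal.ofReal_toReal htop]
  refine ⟨γ, ⟨fun t ht => (hγ t ht).1, ?_, fun s hs t ht => ?_⟩, hγ0, hγ1⟩
  · rw [hγ0, hγ1]
    exact hQ.transportDist_lt_top hμ hν
  · rcases le_total s t with hst | hst
    · rw [hmainE s t hs.1 hst ht.2, abs_sub_comm, abs_of_nonneg (sub_nonneg.2 hst)]
    · rw [hQ.transportDist_comm, hmainE t s ht.1 hst hs.2, abs_of_nonneg (sub_nonneg.2 hst)]

end IsNonlinearMarkovTriple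

end Geodesics

/-! ### The slope of the free energy and the HWI inequality. -/

section FreeEnergy

variable {X : Type*} [Fintype X] [DecidableEq X] {K : (X → ℝ) → X → ℝ}
  {Q : (X → ℝ) → X → X → ℝ}

/-- The differential of the free energy at a strictly positive measure. -/
def freeEnergyGradient (K : (X → ℝ) → X → ℝ) (μ : X → ℝ) (x : X) : ℝ :=
  Real.log (μ x) + 1 + gibbsPotential K μ x

namespace IsNonlinearMarkovTriple

variable (hQ : IsNonlinearMarkovTriple K Q)
include hQ

/-- Differentials along the simplex are not unique; the one used is built from the `gibbsPotential`
that enters detailed balance, as `fisherInfo_eq` requires. -/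
lemma hasFDerivWithinAt_freeEnergy {μ : X → ℝ} (hμ : μ ∈ stdSimplex ℝ X) (hpos : ∀ x, 0 < μ x) :
    HasFDerivWithinAt (freeEnergy K)
      (∑ x, freeEnergyGradient K μ x • ContinuousLinearMap.proj (R := ℝ) (φ := fun _ : X => ℝ) x)
      (stdSimplex ℝ X) μ := by
  have hU : DifferentiableWithinAt ℝ (potentialEnergy K) (stdSimplex ℝ X) μ := by
    refine DifferentiableWithinAt.fun_sum fun x _ => DifferentiableWithinAt.fun_mul
      (differentiableAt_apply x μ).differentiableWithinAt ?_
    exact ((hQ.contDiffOn_potential x).differentiableOn (by norm_num)) μ hμ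
  have hent : HasFDerivAt (fun μ : X → ℝ => ∑ x, μ x * Real.log (μ x))
      (∑ x, (Real.log (μ x) + 1) • ContinuousLinearMap.proj (R := ℝ) (φ := fun _ : X => ℝ) x) μ := by
    refine HasFDerivAt.fun_sum fun x _ => ?_
    exact (Real.hasDerivAt_mul_log (hpos x).ne').comp_hasFDerivAt μ
      ((ContinuousLinearMap.proj (R := ℝ) (φ := fun _ : X => ℝ) x).hasFDerivAt (x := μ))
  have h := hent.hasFDerivWithinAt.fun_add hU.hasFDerivWithinAt
  refine h.congr_fderiv ?_
  ext v
  simp only [add_apply, sum_apply,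
    smul_apply, ContinuousLinearMap.proj_apply, smul_eq_mul,
    freeEnergyGradient, add_mul _ _ (v _), Finset.sum_add_distrib]
  congr 1
  conv_lhs => rw [pi_eq_sum_univ' v]
  rw [map_sum]
  refine Finset.sum_congr rfl fun x _ => ?_
  rw [gibbsPotential, map_smul, smul_eq_mul, mul_comm]

/-- The Fisher information is the action of the differential of the free energy. -/
lemma fisherInfo_eq {μ : X → ℝ} (hμ : μ ∈ stdSimplex ℝ X) (hpos : ∀ x, 0 < μ x) :
    fisherInfo Q μ = ENNReal.ofReal (action Q μ (freeEnergyGradient K μ)) := by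
  rw [fisherInfo, if_pos hpos, action]
  congr 2
  refine Finset.sum_congr rfl fun x _ => Finset.sum_congr rfl fun y _ => ?_
  by_cases hxy : x = y
  · simp [hxy, thetaFn]
  by_cases hq : 0 < Q μ x y
  · have hq' := hQ.rate_pos_comm hμ hq
    have hπ := hQ.detailed_balance μ hμ x y
    have hZ : ∀ z, Real.log (gibbsMeasure K μ z) =
        -gibbsPotential K μ z - Real.log (∑ y, Real.exp (-gibbsPotential K μ y)) := fun z => by
      have hsum : 0 < ∑ y, Real.exp (-gibbsPotential K μ y) :=
        Finset.sum_pos (fun _ _ => Real.exp_pos _) ⟨z, Finset.mem_univ z⟩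
      rw [gibbsMeasure, Real.log_div (Real.exp_pos _).ne' hsum.ne', Real.log_exp]
    have hlog := congrArg Real.log hπ
    rw [Real.log_mul (gibbsMeasure_pos K μ x).ne' hq.ne',
      Real.log_mul (gibbsMeasure_pos K μ y).ne' hq'.ne', hZ, hZ] at hlog
    have ha := mul_pos (hpos x) hq
    have hb := mul_pos (hpos y) hq'
    -- The logarithm of detailed balance gives `H y - H x = log Q(y,x) - log Q(x,y)`; the
    -- normalizing constants cancel.
    have hdiff : freeEnergyGradient K μ y - freeEnergyGradient K μ x =
        -(Real.log (μ x * Q μ x y) - Real.log (μ y * Q μ y x)) := by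
      rw [Real.log_mul (hpos x).ne' hq.ne', Real.log_mul (hpos y).ne' hq'.ne',
        freeEnergyGradient, freeEnergyGradient]
      linarith
    rw [hdiff, thetaFn, edgeWeight, ← logMean_mul_log_sub_log ha hb]
    ring
  · have h0 : Q μ x y = 0 := le_antisymm (not_lt.1 hq) (hQ.rate_nonneg μ hμ x y hxy)
    have h0' : Q μ y x = 0 := le_antisymm
      (not_lt.1 fun h => hq (hQ.rate_pos_comm hμ h)) (hQ.rate_nonneg μ hμ y x (Ne.symm hxy))
    have hlm : logMean 0 0 = 0 := by
      refine le_antisymm ?_ (logMean_nonneg le_rfl le_rfl)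
      have h1 := intervalIntegral.integral_mono_on (zero_le_one (α := ℝ))
        (intervalIntegrable_logMean_integrand le_rfl le_rfl)
        (intervalIntegrable_const (c := (0 : ℝ)) (μ := volume))
        (fun s hs => (logMean_integrand_le le_rfl le_rfl hs).trans (add_zero (0 : ℝ)).le)
      simpa [logMean] using h1
    rw [thetaFn, edgeWeight, h0, h0', mul_zero, mul_zero, hlm]
    ring

lemma continuousOn_action (ψ : X → ℝ) :
    ContinuousOn (fun μ => action Q μ ψ) (stdSimplex ℝ X) := by
  refine continuousOn_const.mul (continuousOn_finsetSum _ fun x _ =>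
    continuousOn_finsetSum _ fun y _ => ?_)
  by_cases hxy : x = y
  · simp only [hxy, sub_self, ne_eq, OfNat.ofNat_ne_zero, not_false_eq_true, zero_pow, zero_mul]
    exact continuousOn_const
  · exact continuousOn_const.mul (hQ.continuousOn_edgeWeight hxy)

/-- Paths of arbitrarily small energy join the two measures, and `exists_dist_le` bounds their
Euclidean displacement. This settles the case `0 · ∞`. -/
lemma eq_of_transportDist_eq_zero {μ ν : X → ℝ} (h : transportDist Q μ ν = 0) : μ = ν := by
  obtain ⟨C, hC, hCb⟩ := hQ.exists_dist_le
  have hle : ∀ e > 0, dist ν μ ≤ C * e := by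
    intro e he
    obtain ⟨m, ψ, hp, h0, h1, hE⟩ := hQ.exists_path_of_transportDist_lt (r := e)
      (by rw [h]; exact ENNReal.ofReal_pos.2 he)
    have := hCb m ψ e hp he hE 1 ⟨zero_le_one, le_rfl⟩
    rwa [h0, h1] at this
  refine (dist_le_zero.1 (le_of_forall_pos_le_add fun ε hε => ?_)).symm
  have := hle (ε / C) (by positivity)
  rwa [mul_div_cancel₀ _ hC.ne', ← zero_add ε] at this

/-- The descending slope of the free energy along a curve `γ` leaving a strictly positive measure
with transport speed at most `W` is bounded by `√I W`. -/
lemma eventually_le_freeEnergy {μ : X → ℝ} (hμ : μ ∈ stdSimplex ℝ X) (hpos : ∀ x, 0 < μ x) {W : ℝ}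
    (hW : 0 ≤ W) {η : ℝ} (hη : 0 < η) {C : ℝ} (hC : 0 < C)
    (hCb : ∀ (m ψ : ℝ → X → ℝ) (e : ℝ), IsPath Q 0 1 m ψ → 0 < e →
      energy Q 0 1 m ψ ≤ ENNReal.ofReal (e ^ 2) → ∀ t ∈ Icc (0 : ℝ) 1, dist (m t) (m 0) ≤ C * e) :
    ∃ t₀ > 0, ∀ t ∈ Ioo 0 t₀, ∀ ν ∈ stdSimplex ℝ X,
      transportDist Q μ ν = ENNReal.ofReal (t * W) →
      freeEnergy K μ - t * ((√(action Q μ (freeEnergyGradient K μ) + η) + η * C) * (W + η)) ≤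
        freeEnergy K ν := by
  set D := freeEnergyGradient K μ with hD
  have hI : 0 ≤ action Q μ D := hQ.action_nonneg hμ D
  -- The slack `η` lets `M ^ 2` bound the action of the fixed `D` on a whole neighbourhood of `μ`.
  set M := √(action Q μ D + η) with hM
  have hM0 : 0 < M := Real.sqrt_pos.2 (by linarith)
  have hMsq : M ^ 2 = action Q μ D + η := Real.sq_sqrt (by linarith)
  have hev1 : ∀ᶠ ν in 𝓝[stdSimplex ℝ X] μ, action Q ν D < M ^ 2 :=
    (hQ.continuousOn_action D μ hμ).eventually (gt_mem_nhds (by linarith))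
  have hev2 := (hQ.hasFDerivWithinAt_freeEnergy hμ hpos).isLittleO.bound hη
  obtain ⟨r, hr, hball⟩ := Metric.mem_nhdsWithin_iff.1 (hev1.and hev2)
  have hWη : 0 < W + η := by linarith
  -- An almost optimal path of length at most `t * (W + η)` then stays in the ball where both
  -- estimates hold. The term `η * C` in the conclusion comes from the linearization error `η * dist
  -- ν μ`.
  refine ⟨r / (C * (W + η)), by positivity, fun t ht ν hν hdist => ?_⟩
  have ht0 := ht.1
  have htr : C * (t * (W + η)) < r := by
    have := (lt_div_iff₀ (by positivity)).1 ht.2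
    linarith
  have he : 0 < t * (W + η) := by positivity
  obtain ⟨m, ψ, hp, h0, h1, hE⟩ := hQ.exists_path_of_transportDist_lt (r := t * (W + η))
    (μ₀ := μ) (μ₁ := ν) (by
      rw [hdist, ENNReal.ofReal_lt_ofReal_iff he]
      nlinarith)
  have hdm := hCb m ψ _ hp he hE
  rw [h0] at hdm
  have I1 : (1 : ℝ) ∈ Icc (0 : ℝ) 1 := ⟨zero_le_one, le_rfl⟩
  have hpair := hQ.abs_sum_mul_increment_le hp he hM0 hE (D := D) I1 fun s hs =>
    (hball ⟨(hdm s hs).trans_lt htr, hp.mem_simplex s hs⟩).1.le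
  rw [h0, h1] at hpair
  have hdν : dist ν μ ≤ C * (t * (W + η)) := h1 ▸ hdm 1 I1
  have hlin := (hball ⟨hdν.trans_lt htr, hν⟩).2
  simp only [sum_apply, smul_apply,
    ContinuousLinearMap.proj_apply, smul_eq_mul, Pi.sub_apply, Real.norm_eq_abs] at hlin
  rw [← hD, ← dist_eq_norm] at hlin
  have h2 := mul_le_mul_of_nonneg_left hdν hη.le
  have h3 := (abs_le.1 hlin).1
  have h4 := (abs_le.1 hpair).1
  nlinarith

/-- The `HWI` inequality at a strictly positive measure. -/
lemma freeEnergy_le_of_pos {κ : ℝ} (hRic : RicciBoundedBelow K Q κ) {μ ν : X → ℝ}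
    (hμ : μ ∈ stdSimplex ℝ X) (hν : ν ∈ stdSimplex ℝ X) (hpos : ∀ x, 0 < μ x) :
    freeEnergy K μ ≤ freeEnergy K ν +
      (transportDist Q μ ν).toReal * √(action Q μ (freeEnergyGradient K μ)) -
        κ / 2 * (transportDist Q μ ν).toReal ^ 2 := by
  obtain ⟨C, hC, hCb⟩ := hQ.exists_dist_le
  obtain ⟨γ, hγ, hγ0, hγ1⟩ := hQ.exists_isGeodesic hμ hν
  have htop := (hQ.transportDist_lt_top hμ hν).ne
  set W := (transportDist Q μ ν).toReal with hW
  have hW0 : 0 ≤ W := ENNReal.toReal_nonneg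
  set I := action Q μ (freeEnergyGradient K μ) with hI
  have key : ∀ η > 0, freeEnergy K μ ≤ freeEnergy K ν - κ / 2 * W ^ 2 +
      ((√(I + η) + η * C) * (W + η) + |κ| / 2 * η * W ^ 2) := by
    intro η hη
    obtain ⟨t₀, ht₀, hslope⟩ := hQ.eventually_le_freeEnergy hμ hpos hW0 hη hC hCb
    obtain ⟨t, ht0, htlt⟩ : ∃ t, 0 < t ∧ t < min t₀ (min η 1) :=
      exists_between (lt_min ht₀ (lt_min hη one_pos))
    have ht1 : t < 1 := htlt.trans_le ((min_le_right _ _).trans (min_le_right _ _))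
    have htη : t < η := htlt.trans_le ((min_le_right _ _).trans (min_le_left _ _))
    have htI : t ∈ Icc (0 : ℝ) 1 := ⟨ht0.le, ht1.le⟩
    have hd := hγ.dist_eq 0 ⟨le_rfl, zero_le_one⟩ t htI
    rw [hγ0, hγ1, zero_sub, abs_neg, abs_of_pos ht0, ← ENNReal.ofReal_toReal htop,
      ← ENNReal.ofReal_mul ht0.le] at hd
    have h1 := hslope t ⟨ht0, htlt.trans_le (min_le_left _ _)⟩ (γ t) (hγ.mem_simplex t htI) hd
    have h2 := hRic γ hγ t htI
    rw [hγ0, hγ1, ← hW] at h2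
    -- Convexity combined with the slope bound; the terms of order zero in `t` cancel, and division
    -- by `t` follows.
    have h3 : t * (freeEnergy K μ) ≤ t * (freeEnergy K ν - κ / 2 * W ^ 2 +
        ((√(I + η) + η * C) * (W + η) + κ / 2 * t * W ^ 2)) := by
      linarith
    have h4 := le_of_mul_le_mul_left h3 ht0
    have h5 : κ / 2 * t * W ^ 2 ≤ |κ| / 2 * η * W ^ 2 := by
      have h6 : κ * t ≤ |κ| * η :=
        mul_le_mul (le_abs_self κ) htη.le ht0.le (abs_nonneg κ)
      have := mul_le_mul_of_nonneg_right h6 (sq_nonneg W)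
      linarith
    linarith
  -- The errors vanish as `η → 0`; the smallness of `t` is already encoded in `t < η`.
  have hlim : Tendsto (fun η : ℝ => freeEnergy K ν - κ / 2 * W ^ 2 +
      ((√(I + η) + η * C) * (W + η) + |κ| / 2 * η * W ^ 2)) (𝓝[>] 0)
      (𝓝 (freeEnergy K ν - κ / 2 * W ^ 2 +
        ((√(I + 0) + 0 * C) * (W + 0) + |κ| / 2 * 0 * W ^ 2))) := by
    refine Tendsto.mono_left (Continuous.tendsto ?_ 0) nhdsWithin_le_nhds
    fun_prop
  have := ge_of_tendsto hlim (eventually_nhdsWithin_of_forall fun η hη => key η hη)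
  simp only [add_zero, zero_mul, mul_zero] at this
  linarith

end IsNonlinearMarkovTriple

end FreeEnergy

end MeanField

end

theorem theorem4p2 {X : Type*} [Fintype X] [DecidableEq X]
    (K : (X → ℝ) → X → ℝ) (Q : (X → ℝ) → X → X → ℝ)
    (hQ : MeanField.IsNonlinearMarkovTriple K Q)
    (κ : ℝ) (hRic : MeanField.RicciBoundedBelow K Q κ)
    (μ ν : X → ℝ) (hμ : μ ∈ stdSimplex ℝ X) (hν : ν ∈ stdSimplex ℝ X) :
    MeanField.transportDist Q μ ν < ⊤ ∧
      (MeanField.freeEnergy K μ : EReal) ≤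
        (MeanField.freeEnergy K ν : EReal)
          + ((MeanField.transportDist Q μ ν * MeanField.fisherInfo Q μ ^ (1 / 2 : ℝ) : ℝ≥0∞) : EReal)
          - ((κ / 2 * (MeanField.transportDist Q μ ν).toReal ^ 2 : ℝ) : EReal) := by
  have hlt := hQ.transportDist_lt_top hμ hν
  refine ⟨hlt, ?_⟩
  by_cases hpos : ∀ x, 0 < μ x
  · have h := hQ.freeEnergy_le_of_pos hRic hμ hν hpos
    have hI := hQ.action_nonneg hμ (MeanField.freeEnergyGradient K μ)
    have hprod : MeanField.transportDist Q μ ν * MeanField.fisherInfo Q μ ^ (1 / 2 : ℝ) =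
        ENNReal.ofReal ((MeanField.transportDist Q μ ν).toReal *
          √(MeanField.action Q μ (MeanField.freeEnergyGradient K μ))) := by
      rw [ENNReal.ofReal_mul ENNReal.toReal_nonneg, ENNReal.ofReal_toReal hlt.ne,
        hQ.fisherInfo_eq hμ hpos, ENNReal.ofReal_rpow_of_nonneg hI (by norm_num),
        Real.sqrt_eq_rpow]
    rw [hprod, EReal.coe_ennreal_ofReal, max_eq_left (by positivity)]
    exact_mod_cast h
  · have hinf : MeanField.fisherInfo Q μ ^ (1 / 2 : ℝ) = ⊤ := by
      rw [MeanField.fisherInfo, if_neg hpos, ENNReal.top_rpow_of_pos (by norm_num)]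
    -- The right-hand side is `⊤` unless the distance vanishes; then the measures coincide and the
    -- convention `0 * ⊤ = 0` leaves an equality.
    rcases eq_or_ne (MeanField.transportDist Q μ ν) 0 with h0 | h0
    · obtain rfl := hQ.eq_of_transportDist_eq_zero h0
      rw [h0]
      simp
    · rw [hinf, ENNReal.mul_top h0, EReal.coe_ennreal_top, EReal.coe_add_top, EReal.top_sub_coe]
      exact le_top
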